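/- A polytope is the convex hull of finitely many points in a finite-dimensional real vector space; its faces include $\emptyset$ (of dimension $-1$) and the polytope itself. For a polytope $P$, the toric polynomials $h(P,x),g(P,x)\in\mathbb Z[x]$ are defined recursively by $h(\emptyset,x)=g(\emptyset,x)=1$ and, if $\dim P=d\ge 0$, $$h(P,x)=\sum_{G\text{ face of }P,\;G\ne P} g(G,x)(x-1)^{d-1-\dim G}=\sum_{i=0}^{d}h_i(P)x^{d-i},\qquad g(P,x)=\sum_{i=0}^{\lfloor d/2\rfloor}g_i(P)x^i,$$ where $g_0=h_0$ and $g_i=h_i-h_{i-1}$ for $1\le i\le d/2$. For $d\ge 2$, a $d$-dimensional multiplex is a $d$-dimensional polytope whose vertices can be listed as $x_0,x_1,\dots,x_n$ in such a way that its facets are $$F_i=\operatorname{conv}\{x_{i-d+1},\dots,x_{i-1},x_{i+1},\dots,x_{i+d-1}\},\qquad 0\le i\le n,$$ with the conventions $x_k=x_0$ for $k<0$ and $x_k=x_n$ for $k>n$; all points and segments are multiplexes as well. A multiplicial $d$-polytope is a $d$-dimensional polytope all of whose nonempty proper faces are multiplexes. For a $d$-polytope $P$ let $f_j=f_j(P)$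 be the number of $j$-dimensional faces of $P$, and let $f_{0,j}=f_{0,j}(P)$ be the sum, over all $j$-dimensional faces of $P$, of their numbers of vertices. Put $\bar f_{-1}(P)=f_{-1}=1$, $\bar f_0(P)=f_0$, $\bar f_{d-1}(P)=f_{d-1}+(f_{0,d-1}-d f_{d-1})$, and, for $1\le j\le d-2$, $$\bar f_j(P)=f_j+(f_{0,j+1}-(j+2)f_{j+1})+(f_{0,j}-(j+1)f_j).$$ Theorem. If $P$ is a multiplicial $d$-polytope, $d\ge 0$, then $$h(P,x)=\sum_{i=0}^d h_i(P)x^{d-i}=\sum_{i=0}^d\bar f_{i-1}(P)(x-1)^{d-i}.$$ -/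

import Mathlib

open Polynomial

namespace ConvPoly

noncomputable section

variable {E : Type*} [NormedAddCommGroup E] [NormedSpace ℝ E]

/-- A convex polytope: the convex hull of a finite set of points. -/
def IsPolytope (P : Set E) : Prop :=
  ∃ S : Finset E, P = convexHull ℝ (S : Set E)

/-- `G` is a face of `P`: either `G = ∅`, or `G` is the set of points of `P` at which some linear
functional attains its maximum on `P`. Both `∅` and `P` are faces of `P`. -/
def IsFace (P G : Set E) : Prop :=
  IsExposed ℝ P G

open Classical in
/-- The dimension of the affine hull of `F`, with the convention `dim ∅ = -1`. -/
def dim (F : Set E) : ℤ :=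
  if F = ∅ then -1 else (Module.finrank ℝ (vectorSpan ℝ F) : ℤ)

/-- The vertices of `P`: the points `v` such that `{v}` is a face. -/
def vertices (P : Set E) : Set E :=
  {v | IsFace P {v}}

/-- A facet of `P`: a face of dimension `dim P - 1`. -/
def IsFacet (P F : Set E) : Prop :=
  IsFace P F ∧ dim F = dim P - 1

theorem dim_nonneg {F : Set E} (hF : F ≠ ∅) : 0 ≤ dim F := by
  simp [dim, hF]

/-- Proper faces have smaller dimension. -/
theorem dim_lt_of_properFace [FiniteDimensional ℝ E] {P G : Set E}
    (hG : IsFace P G) (hne : G ≠ P) : dim G < dim P := by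
  rcases Set.eq_empty_or_nonempty G with rfl | hGn
  · have := dim_nonneg (Ne.symm hne)
    have h : dim (∅ : Set E) = -1 := by simp [dim]
    omega
  · obtain ⟨l, hl⟩ := hG hGn
    have hsub : G ⊆ P := by
      rw [hl]; exact fun x hx => hx.1
    have hPne : P ≠ ∅ := (hGn.mono hsub).ne_empty
    have hlt : vectorSpan ℝ G < vectorSpan ℝ P := by
      refine lt_of_le_of_ne (vectorSpan_mono ℝ hsub) fun heq => hne ?_
      have hker : vectorSpan ℝ G ≤ LinearMap.ker (l : E →ₗ[ℝ] ℝ) := by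
        rw [vectorSpan_def, Submodule.span_le]
        rintro _ ⟨a, ha, b, hb, rfl⟩
        rw [hl] at ha hb
        have h1 := ha.2 b hb.1
        have h2 := hb.2 a ha.1
        simp only [vsub_eq_sub, SetLike.mem_coe, LinearMap.mem_ker, map_sub,
          ContinuousLinearMap.coe_coe]
        linarith
      refine Set.Subset.antisymm hsub fun p hp => ?_
      obtain ⟨a, ha⟩ := hGn
      have hmem : p -ᵥ a ∈ vectorSpan ℝ P := vsub_mem_vectorSpan ℝ hp (hsub ha)
      rw [← heq] at hmem
      have h0 := hker hmem
      simp only [vsub_eq_sub, LinearMap.mem_ker, map_sub, ContinuousLinearMap.coe_coe] at h0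
      rw [hl] at ha ⊢
      refine ⟨hp, fun y hy => ?_⟩
      have := ha.2 y hy
      linarith
    have := Submodule.finrank_lt_finrank_of_lt hlt
    simp only [dim, hGn.ne_empty, hPne, if_false]
    exact_mod_cast this

/-- If `h = ∑ i ≤ d, h_i x^(d-i)`, this is `h_i`. -/
def hCoeff (d : ℕ) (h : ℤ[X]) (i : ℕ) : ℤ :=
  h.coeff (d - i)

/-- The polynomial `∑_{i ≤ d/2} g_i x^i` with `g_0 = h_0` and `g_i = h_i - h_{i-1}`, where
`h = ∑ i ≤ d, h_i x^(d-i)`. -/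
def gOfH (d : ℕ) (h : ℤ[X]) : ℤ[X] :=
  ∑ i ∈ Finset.range (d / 2 + 1),
    C (if i = 0 then hCoeff d h 0 else hCoeff d h i - hCoeff d h (i - 1)) * X ^ i

open Classical in
/-- The toric `h`-polynomial of (the boundary of) `P`: `h(∅) = 1`, and for nonempty `P`
`h(P, x) = ∑ g(G, x) (x - 1)^(dim P - 1 - dim G)` over all faces `G ≠ P`, including `G = ∅`. -/
def toricH [FiniteDimensional ℝ E] (P : Set E) : ℤ[X] :=
  if P = ∅ then 1
  else ∑ᶠ G : {G : Set E // IsFace P G ∧ G ≠ P},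
    gOfH (dim G.1).toNat (toricH G.1) * (X - 1) ^ (dim P - 1 - dim G.1).toNat
termination_by (dim P + 1).toNat
decreasing_by
  have h1 := dim_lt_of_properFace G.2.1 G.2.2
  have h2 : P ≠ ∅ := by assumption
  have h3 := dim_nonneg h2
  omega

/-- The toric `g`-polynomial of `P`. -/
def toricG [FiniteDimensional ℝ E] (P : Set E) : ℤ[X] :=
  gOfH (dim P).toNat (toricH P)

theorem toricH_empty [FiniteDimensional ℝ E] : toricH (∅ : Set E) = 1 := by
  rw [toricH]; simp

theorem toricG_empty [FiniteDimensional ℝ E] : toricG (∅ : Set E) = 1 := by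
  simp [toricG, toricH_empty, dim, gOfH, hCoeff]

/-- The defining recursion of the toric `h`-polynomial. -/
theorem toricH_eq [FiniteDimensional ℝ E] {P : Set E} (hP : P ≠ ∅) :
    toricH P = ∑ᶠ G : {G : Set E // IsFace P G ∧ G ≠ P},
      toricG G.1 * (X - 1) ^ (dim P - 1 - dim G.1).toNat := by
  rw [toricH, if_neg hP]; rfl

/-- The entry `h_i(P)` of the toric `h`-vector, defined by `h(P, x) = ∑ i ≤ d, h_i(P) x^(d-i)`,
where `d = dim P`. -/
def toricHVec [FiniteDimensional ℝ E] (P : Set E) (i : ℕ) : ℤ :=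
  hCoeff (dim P).toNat (toricH P) i

/-- `f_j(P)`, the number of `j`-dimensional faces of `P` (so `f_{-1}(P) = 1`). -/
def fNum (P : Set E) (j : ℤ) : ℕ :=
  {F : Set E | IsFace P F ∧ dim F = j}.ncard

/-- `f_{0,j}(P)`, the sum over the `j`-dimensional faces of `P` of their numbers of vertices. -/
def fZeroNum (P : Set E) (j : ℤ) : ℕ :=
  ∑ᶠ F : {F : Set E // IsFace P F ∧ dim F = j}, (vertices F.1).ncard

/-- The excess vertex count `f_{0,j} - (j+1) f_j`. -/
def excess (P : Set E) (j : ℤ) : ℤ :=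
  (fZeroNum P j : ℤ) - (j + 1) * (fNum P j : ℤ)

/-- The modified face number `f̄_j(P)`, for `-1 ≤ j ≤ dim P - 1`. -/
def fBar (P : Set E) (j : ℤ) : ℤ :=
  if j = -1 then 1
  else if j = 0 then (fNum P 0 : ℤ)
  else if j = dim P - 1 then (fNum P j : ℤ) + excess P j
  else (fNum P j : ℤ) + excess P (j + 1) + excess P j

/-- The convention `x_k = x_0` for `k < 0` and `x_k = x_n` for `k > n`. -/
def extendList {n : ℕ} (x : Fin (n + 1) → E) (k : ℤ) : E :=
  x ⟨min k.toNat n, Nat.lt_succ_of_le (min_le_right _ _)⟩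

/-- `M` is a `d`-dimensional multiplex: for `d ≥ 2` its vertices can be listed as `x_0, …, x_n`
so that its facets are the sets
`F_i = conv {x_{i-d+1}, …, x_{i-1}, x_{i+1}, …, x_{i+d-1}}`, `0 ≤ i ≤ n`.
Points and segments (`d ≤ 1`) are multiplexes. -/
def IsMultiplex (d : ℕ) (M : Set E) : Prop :=
  IsPolytope M ∧ dim M = d ∧
    (d ≤ 1 ∨ ∃ (n : ℕ) (x : Fin (n + 1) → E),
      Function.Injective x ∧ Set.range x = vertices M ∧
      ∀ F : Set E, IsFacet M F ↔ ∃ i : ℕ, i ≤ n ∧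
        F = convexHull ℝ (extendList x '' (Set.Icc ((i : ℤ) - d + 1) ((i : ℤ) + d - 1) \ {(i : ℤ)})))

/-- `P` is a multiplicial `d`-polytope: a `d`-dimensional polytope all of whose (nonempty) proper
faces are multiplexes. -/
def IsMultiplicial (d : ℕ) (P : Set E) : Prop :=
  IsPolytope P ∧ dim P = d ∧
    ∀ F : Set E, IsFace P F → F ≠ ∅ → F ≠ P → ∃ e : ℕ, IsMultiplex e F

end

end ConvPoly

/-! For a multiplex G the toric g-polynomial is linear: g(G,x) = 1 + c(G)x, where c(G) = f_0(G) -
dim G - 1 (`IsLabelledMultiplex.toricG_eq`). Proper faces of a multiplicial polytope are multiplexes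
or empty, so the recursion for h(P,x) becomes a sum of terms (1 + c(G)x)(x-1)^(d-1-dim G). Writing x
= (x-1) + 1 and collecting powers of x-1 gives exactly the modified face numbers.

Linearity of g is proved by counting. Label the vertices of a d-dimensional multiplex M by 0,...,n,
and consider the sets S of labels of diameter at most d. With y = x-1, the sum of y^(d+1-|S|) is
x^(d+1) + (n-d)x^d (`sum_closeSets`). Now group the sets S by their carrier, the smallest face
containing the corresponding vertices. A face of dimension e with excess c carries c+1 sets of size
e+1 and c sets of size e, contributing (c+1)y^(d-e) + c y^(d-e+1) = (1+cx)y^(d-e). Hence the sum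
over all faces of (1+cx)(x-1)^(d-dim G) is known (`IsLabelledMultiplex.sum_linearG`). By induction
on dimension this determines h(M,x), whose coefficients are 1, 1+c, ..., 1+c, 1, and g(M,x) follows.

The count of carried sets needs every nonempty face of a multiplex to be a multiplex in the induced
vertex order, with diameter at most d in M corresponding to diameter at most e in the face
(`IsLabelledMultiplex.face`). This is obtained by descending through facets, since a facet of a
facet is an intersection of two facets. -/

namespace ConvPoly

/-! ### Exposed faces and vertices of polytopes. -/

section Geometry

variable {E : Type*} [NormedAddCommGroup E] [NormedSpace ℝ E]

theorem IsFace.subset {P G : Set E} (h : IsFace P G) : G ⊆ P :=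
  IsExposed.subset h

theorem IsFace.mono {P F G : Set E} (h : IsFace P G) (hF : F ⊆ P) (hG : G ⊆ F) : IsFace F G :=
  IsExposed.mono h hF hG

theorem IsFace.inter {P F G : Set E} (hF : IsFace P F) (hG : IsFace P G) : IsFace P (F ∩ G) :=
  IsExposed.inter hF hG

theorem IsFace.refl (P : Set E) : IsFace P P :=
  IsExposed.refl P

theorem isFace_empty (P : Set E) : IsFace P (∅ : Set E) :=
  isExposed_empty

theorem dim_empty : dim (∅ : Set E) = -1 := by simp [dim]

theorem dim_of_nonempty {F : Set E} (hF : F.Nonempty) :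
    dim F = Module.finrank ℝ (vectorSpan ℝ F) := by
  simp [dim, hF.ne_empty]

theorem neg_one_le_dim (F : Set E) : -1 ≤ dim F := by
  rcases F.eq_empty_or_nonempty with rfl | h
  · simp [dim_empty]
  · have := dim_nonneg h.ne_empty
    omega

theorem nonempty_of_dim_nonneg {F : Set E} (h : 0 ≤ dim F) : F.Nonempty := by
  by_contra hF
  rw [Set.not_nonempty_iff_eq_empty] at hF
  subst hF
  rw [dim_empty] at h
  omega

/-- The part of a convex hull on a supporting hyperplane is the convex hull of the generators on
the hyperplane. -/
theorem convexHull_inter_eq_of_forall_le {S : Set E} (l : StrongDual ℝ E) (c : ℝ)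
    (h : ∀ v ∈ S, l v ≤ c) :
    {p ∈ convexHull ℝ S | l p = c} = convexHull ℝ {v ∈ S | l v = c} := by
  have hcl : ∀ p ∈ convexHull ℝ {v ∈ S | l v = c}, l p = c := by
    intro p hp
    have hconv : Convex ℝ {p : E | l p = c} := convex_hyperplane l.toLinearMap.isLinear c
    exact convexHull_min (fun v hv => hv.2) hconv hp
  apply Set.Subset.antisymm
  · rintro p ⟨hp, hpc⟩
    -- The open half-space `l < c` together with the hull of the tight generators is convex and
    -- contains `S`, hence contains the whole hull.
    have hK : Convex ℝ ({p : E | l p < c} ∪ convexHull ℝ {v ∈ S | l v = c}) := by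
      rintro a ha b hb s t hs ht hst
      have hle : ∀ q ∈ {p : E | l p < c} ∪ convexHull ℝ {v ∈ S | l v = c}, l q ≤ c := by
        rintro q (hq | hq)
        · exact le_of_lt hq
        · exact (hcl q hq).le
      have ha' := hle a ha
      have hb' := hle b hb
      rcases hs.eq_or_lt with rfl | hs
      · obtain rfl : t = 1 := by linarith
        simpa using hb
      rcases ht.eq_or_lt with rfl | ht
      · obtain rfl : s = 1 := by linarith
        simpa using ha
      have hlt : l a < c ∨ l b < c → l (s • a + t • b) < c := by
        intro hab
        simp only [map_add, map_smul, smul_eq_mul]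
        have hc : c = s * c + t * c := by rw [← add_mul, hst, one_mul]
        rcases hab with hab | hab <;> nlinarith
      rcases ha with ha | ha
      · exact Or.inl (hlt (Or.inl ha))
      rcases hb with hb | hb
      · exact Or.inl (hlt (Or.inr hb))
      exact Or.inr (convex_convexHull ℝ _ ha hb hs.le ht.le hst)
    have hsub : S ⊆ {p : E | l p < c} ∪ convexHull ℝ {v ∈ S | l v = c} := by
      intro v hv
      rcases (h v hv).lt_or_eq with h1 | h1
      · exact Or.inl h1
      · exact Or.inr (subset_convexHull ℝ _ ⟨hv, h1⟩)
    rcases convexHull_min hsub hK hp with h1 | h1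
    · exact absurd hpc (ne_of_lt h1)
    · exact h1
  · exact fun p hp => ⟨convexHull_mono (fun v hv => hv.1) hp, hcl p hp⟩

theorem forall_convexHull_le {S : Set E} {l : StrongDual ℝ E} {c : ℝ} (h : ∀ v ∈ S, l v ≤ c) :
    ∀ p ∈ convexHull ℝ S, l p ≤ c :=
  fun _ hp => convexHull_min h (convex_halfSpace_le l.toLinearMap.isLinear c) hp

theorem isFace_of_forall_le {S : Set E} (l : StrongDual ℝ E) (c : ℝ) (h : ∀ v ∈ S, l v ≤ c) :
    IsFace (convexHull ℝ S) {p ∈ convexHull ℝ S | l p = c} := by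
  rintro ⟨a, ha, hac⟩
  have hle := forall_convexHull_le h
  refine ⟨l, Set.Subset.antisymm ?_ ?_⟩
  · rintro p ⟨hp, hpc⟩
    exact ⟨hp, fun y hy => (hle y hy).trans hpc.ge⟩
  · rintro p ⟨hp, hpm⟩
    exact ⟨hp, le_antisymm (hle p hp) (hac ▸ hpm a ha)⟩

/-- A nonempty face is cut out by a supporting hyperplane. -/
theorem IsFace.exists_functional {P G : Set E} (h : IsFace P G) (hG : G.Nonempty) :
    ∃ (l : StrongDual ℝ E) (c : ℝ), (∀ p ∈ P, l p ≤ c) ∧ G = {p ∈ P | l p = c} := by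
  obtain ⟨l, hl⟩ := h hG
  obtain ⟨a, ha⟩ := hG
  have ha' := ha
  rw [hl] at ha'
  refine ⟨l, l a, ha'.2, ?_⟩
  rw [hl]
  ext p
  constructor
  · exact fun hp => ⟨hp.1, le_antisymm (ha'.2 p hp.1) (hp.2 a ha'.1)⟩
  · exact fun hp => ⟨hp.1, fun y hy => (ha'.2 y hy).trans hp.2.ge⟩

theorem IsFace.eq_convexHull {S G : Set E} (h : IsFace (convexHull ℝ S) G) :
    G = convexHull ℝ (S ∩ G) := by
  rcases G.eq_empty_or_nonempty with rfl | hG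
  · simp
  obtain ⟨l, c, hle, hl⟩ := h.exists_functional hG
  have hS : S ⊆ convexHull ℝ S := subset_convexHull ℝ S
  have h1 := convexHull_inter_eq_of_forall_le l c (fun v hv => hle v (hS hv))
  rw [← hl] at h1
  have h2 : S ∩ G = {v ∈ S | l v = c} := by
    ext v
    constructor
    · rintro ⟨hv, hvG⟩
      rw [hl] at hvG
      exact ⟨hv, hvG.2⟩
    · rintro ⟨hv, hvc⟩
      refine ⟨hv, ?_⟩
      rw [hl]
      exact ⟨hS hv, hvc⟩
  rw [h2]
  exact h1

theorem IsFace.isPolytope {P G : Set E} (hP : IsPolytope P) (h : IsFace P G) : IsPolytope G := by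
  classical
  obtain ⟨S, rfl⟩ := hP
  refine ⟨S.filter (· ∈ G), ?_⟩
  conv_lhs => rw [h.eq_convexHull]
  congr 1
  ext v
  simp

/-- A face is determined by the generators it contains. -/
theorem IsPolytope.finite_faces {P : Set E} (hP : IsPolytope P) : {G | IsFace P G}.Finite := by
  obtain ⟨S, rfl⟩ := hP
  refine Set.Finite.of_finite_image (f := fun G => (S : Set E) ∩ G) ?_ ?_
  · refine (S.finite_toSet.powerset).subset ?_
    rintro _ ⟨G, -, rfl⟩
    exact Set.inter_subset_left
  · intro G hG G' hG' h
    rw [IsFace.eq_convexHull hG, IsFace.eq_convexHull hG']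
    exact congrArg _ h

/-- Tilt one affine functional by another until a new point becomes tight. -/
theorem exists_tilt {ι : Type*} (S : Finset ι) (A B : ι → ℝ) (hA : ∀ v ∈ S, A v ≤ 0)
    (hAB : ∀ v ∈ S, A v = 0 → B v ≤ 0) (hB : ∃ v ∈ S, 0 < B v) :
    ∃ t : ℝ, 0 < t ∧ (∀ v ∈ S, A v + t * B v ≤ 0) ∧ ∃ v ∈ S, 0 < B v ∧ A v + t * B v = 0 := by
  classical
  obtain ⟨v0, hv0, hBv0⟩ := hB
  -- Ratio test: the smallest `-A v / B v` over the points with `B v > 0` is the first parameter at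
  -- which such a point becomes tight.
  obtain ⟨w, hw, hmin⟩ := (S.filter (0 < B ·)).exists_min_image (fun v => -A v / B v)
    ⟨v0, by simp [hv0, hBv0]⟩
  simp only [Finset.mem_filter] at hw hmin
  have hAw : A w < 0 := lt_of_le_of_ne (hA w hw.1) fun h => absurd (hAB w hw.1 h) (not_le.2 hw.2)
  refine ⟨-A w / B w, div_pos (by linarith) hw.2, fun v hv => ?_, w, hw.1, hw.2, ?_⟩
  · rcases le_or_gt (B v) 0 with h | h
    · have : (-A w / B w) * B v ≤ 0 :=
        mul_nonpos_of_nonneg_of_nonpos (div_nonneg (by linarith) hw.2.le) h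
      linarith [hA v hv]
    · have h1 := hmin v ⟨hv, h⟩
      have h2 : (-A w / B w) * B v ≤ -A v := by
        calc (-A w / B w) * B v ≤ (-A v / B v) * B v := mul_le_mul_of_nonneg_right h1 h.le
          _ = -A v := div_mul_cancel₀ _ h.ne'
      linarith
  · rw [div_mul_cancel₀ _ hw.2.ne']
    ring

/-- Faces of faces of a polytope are faces. -/
theorem IsFace.trans {P F G : Set E} (hP : IsPolytope P) (hF : IsFace P F) (hG : IsFace F G) :
    IsFace P G := by
  rcases G.eq_empty_or_nonempty with rfl | hGn
  · exact isFace_empty P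
  obtain ⟨S, rfl⟩ := hP
  have hS : (S : Set E) ⊆ convexHull ℝ (S : Set E) := subset_convexHull ℝ _
  obtain ⟨l, c, hle, hl⟩ := hF.exists_functional (hGn.mono hG.subset)
  obtain ⟨m, e, hme, hm⟩ := hG.exists_functional hGn
  -- A large multiple of the functional of `F` dominates at the finitely many generators off `F`,
  -- while on `F` only `m` matters.
  have key : ∃ t : ℝ, 0 < t ∧ (∀ v ∈ S, (m v - e) + t * (l v - c) ≤ 0) ∧
      ∀ v ∈ S, (m v - e) + t * (l v - c) = 0 → l v = c := by
    obtain ⟨t0, ht0⟩ : ∃ t0 : ℝ, ∀ v ∈ S, l v < c → (m v - e) / (c - l v) < t0 := by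
      classical
      obtain ⟨t0, ht0⟩ := ((S.image fun v => (m v - e) / (c - l v)).finite_toSet).bddAbove
      refine ⟨t0 + 1, fun v hv _ => ?_⟩
      have := ht0 (Finset.mem_coe.2 (Finset.mem_image_of_mem (fun v => (m v - e) / (c - l v)) hv))
      linarith
    have hmain : ∀ v ∈ S, l v < c → (m v - e) + max t0 1 * (l v - c) < 0 := by
      intro v hv h
      have h1 := (ht0 v hv h).trans_le (le_max_left t0 1)
      rw [div_lt_iff₀ (by linarith)] at h1
      linarith
    refine ⟨max t0 1, by positivity, fun v hv => ?_, fun v hv h => ?_⟩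
    · rcases (hle v (hS hv)).lt_or_eq with h | h
      · exact (hmain v hv h).le
      · have : v ∈ F := by rw [hl]; exact ⟨hS hv, h⟩
        rw [h]
        linarith [hme v this]
    · by_contra hne
      exact absurd h (hmain v hv (lt_of_le_of_ne (hle v (hS hv)) hne)).ne
  obtain ⟨t, ht, hle', htight⟩ := key
  have hval : ∀ p, (m + t • l) p = m p + t * l p := fun p => by simp
  have hface := isFace_of_forall_le (S := (S : Set E)) (m + t • l) (e + t * c) (fun v hv => by
    rw [hval]; linarith [hle' v hv])
  have hsubF : {p ∈ convexHull ℝ (S : Set E) | (m + t • l) p = e + t * c} ⊆ F := by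
    rw [convexHull_inter_eq_of_forall_le _ _ (fun v hv => by
      rw [hval]; linarith [hle' v hv])]
    have hconv : Convex ℝ F := by
      rw [hF.eq_convexHull]
      exact convex_convexHull ℝ _
    refine convexHull_min ?_ hconv
    rintro v ⟨hv, hv'⟩
    rw [hval] at hv'
    rw [hl]
    exact ⟨hS hv, htight v hv (by linarith)⟩
  convert hface using 1
  ext p
  constructor
  · intro hp
    have hpF := hG.subset hp
    rw [hm] at hp
    rw [hl] at hpF
    refine ⟨hpF.1, ?_⟩
    rw [hval, hp.2, hpF.2]
  · intro hp
    have hpF := hsubF hp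
    have hpF' := hpF
    rw [hl] at hpF'
    rw [hm]
    refine ⟨hpF, ?_⟩
    have := hp.2
    rw [hval, hpF'.2] at this
    linarith

theorem IsPolytope.convex {P : Set E} (hP : IsPolytope P) : Convex ℝ P := by
  obtain ⟨S, rfl⟩ := hP
  exact convex_convexHull ℝ _

theorem mem_vertices {P : Set E} {v : E} : v ∈ vertices P ↔ IsFace P {v} := Iff.rfl

theorem vertices_subset {P : Set E} : vertices P ⊆ P :=
  fun _ hv => IsFace.subset hv rfl

theorem IsFace.vertices_eq {P F : Set E} (hP : IsPolytope P) (hF : IsFace P F) :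
    vertices F = vertices P ∩ F := by
  ext v
  constructor
  · exact fun hv => ⟨hF.trans hP hv, vertices_subset hv⟩
  · rintro ⟨hv, hvF⟩
    exact IsFace.mono hv hF.subset (Set.singleton_subset_iff.2 hvF)

/-- A vertex of `P` lies in the convex hull of a subset of `P` only if it belongs to it. -/
theorem mem_of_mem_vertices_of_mem_convexHull {P T : Set E} {v : E} (hv : v ∈ vertices P)
    (hT : T ⊆ P) (h : v ∈ convexHull ℝ T) : v ∈ T := by
  obtain ⟨l, c, hle, hl⟩ := IsFace.exists_functional hv (Set.singleton_nonempty v)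
  have hvc : v ∈ {p ∈ P | l p = c} := hl ▸ Set.mem_singleton v
  by_contra hvT
  have hlt : T ⊆ {p | l p < c} := by
    intro p hp
    refine lt_of_le_of_ne (hle p (hT hp)) fun heq => hvT ?_
    have : p ∈ ({v} : Set E) := by rw [hl]; exact ⟨hT hp, heq⟩
    rw [Set.mem_singleton_iff] at this
    exact this ▸ hp
  exact absurd hvc.2 (ne_of_lt (convexHull_min hlt (convex_halfSpace_lt l.toLinearMap.isLinear c) h))

theorem vertices_convexHull_subset {S : Set E} : vertices (convexHull ℝ S) ⊆ S :=
  fun _ hv => mem_of_mem_vertices_of_mem_convexHull hv (subset_convexHull ℝ S) (vertices_subset hv)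

theorem IsPolytope.finite_vertices {P : Set E} (hP : IsPolytope P) : (vertices P).Finite := by
  obtain ⟨S, rfl⟩ := hP
  exact S.finite_toSet.subset vertices_convexHull_subset

/-- A functional attains its maximum over a nonempty polytope on a nonempty face. -/
theorem IsPolytope.exists_isFace_max {P : Set E} (hP : IsPolytope P) (hne : P.Nonempty)
    (l : StrongDual ℝ E) :
    ∃ G, IsFace P G ∧ G.Nonempty ∧ ∀ p ∈ G, ∀ q ∈ P, l q ≤ l p := by
  obtain ⟨S, rfl⟩ := hP
  have hSne : S.Nonempty := by
    rw [convexHull_nonempty_iff] at hne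
    exact_mod_cast hne
  obtain ⟨v, hv, hmax⟩ := S.exists_max_image l hSne
  have hle := forall_convexHull_le (S := (S : Set E)) (l := l) (c := l v) hmax
  refine ⟨_, isFace_of_forall_le (S := (S : Set E)) l (l v) hmax,
    ⟨v, subset_convexHull ℝ _ hv, rfl⟩, ?_⟩
  rintro p ⟨-, hp⟩ q hq
  rw [hp]
  exact hle q hq

/-- If `P` has two distinct points it has a nonempty proper face. -/
theorem IsPolytope.exists_properFace {P : Set E} (hP : IsPolytope P) {a b : E} (ha : a ∈ P)
    (hb : b ∈ P) (hab : a ≠ b) : ∃ G, IsFace P G ∧ G.Nonempty ∧ G ≠ P := by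
  obtain ⟨l, hl⟩ := SeparatingDual.exists_separating_of_ne (R := ℝ) hab
  obtain ⟨G, hG, hGn, hmax⟩ := hP.exists_isFace_max ⟨a, ha⟩ l
  refine ⟨G, hG, hGn, ?_⟩
  rintro rfl
  exact hl (le_antisymm (hmax b hb a ha) (hmax a ha b hb))

theorem IsFacet.ne {P F : Set E} (hF : IsFacet P F) : F ≠ P := by
  rintro rfl
  have := hF.2
  omega

variable [FiniteDimensional ℝ E]

/-- A nonempty face of least dimension is a point: two distinct points in it could be separated by a
functional, whose maximum would cut out a smaller face. -/
theorem IsPolytope.exists_vertex {P : Set E} (hP : IsPolytope P) (hne : P.Nonempty) :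
    (vertices P).Nonempty := by
  have hfin : {G | IsFace P G ∧ G.Nonempty}.Finite := hP.finite_faces.subset fun G hG => hG.1
  obtain ⟨G, ⟨hG, hGn⟩, hmin⟩ := Set.exists_min_image _ dim hfin ⟨P, IsFace.refl P, hne⟩
  obtain ⟨a, ha⟩ := hGn
  refine ⟨a, ?_⟩
  have : G = {a} := by
    refine Set.Subset.antisymm (fun b hb => ?_) (Set.singleton_subset_iff.2 ha)
    by_contra hba
    obtain ⟨G', hG', hG'n, hne'⟩ := (hG.isPolytope hP).exists_properFace hb ha hba
    have h1 := hmin G' ⟨hG.trans hP hG', hG'n⟩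
    have h2 := dim_lt_of_properFace hG' hne'
    omega
  rw [mem_vertices, ← this]
  exact hG

/-- A polytope is the convex hull of its vertices. -/
theorem IsPolytope.convexHull_vertices {P : Set E} (hP : IsPolytope P) :
    convexHull ℝ (vertices P) = P := by
  refine Set.Subset.antisymm (convexHull_min vertices_subset hP.convex) fun p hp => ?_
  by_contra hnot
  obtain ⟨l, u, hl1, hl2⟩ := geometric_hahn_banach_closed_point
    (convex_convexHull ℝ (vertices P)) (hP.finite_vertices.isClosed_convexHull ℝ) hnot
  obtain ⟨G, hG, hGn, hmax⟩ := hP.exists_isFace_max ⟨p, hp⟩ l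
  obtain ⟨v, hv⟩ := (hG.isPolytope hP).exists_vertex hGn
  have h1 := hl1 v (subset_convexHull ℝ _ (hG.trans hP hv))
  have h2 := hmax v (vertices_subset hv) p hp
  linarith

theorem IsFace.convexHull_vertices_inter {P F : Set E} (hP : IsPolytope P) (hF : IsFace P F) :
    convexHull ℝ (vertices P ∩ F) = F := by
  rw [← hF.vertices_eq hP, (hF.isPolytope hP).convexHull_vertices]

theorem IsFace.exists_vertex_notMem {P F : Set E} (hP : IsPolytope P) (hF : IsFace P F)
    (hne : F ≠ P) : ∃ v ∈ vertices P, v ∉ F := by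
  by_contra! h
  refine hne (Set.Subset.antisymm hF.subset ?_)
  rw [← hP.convexHull_vertices]
  exact convexHull_min h (hF.isPolytope hP).convex

theorem IsFace.eq_of_subset_of_dim_eq {P F G : Set E} (hF : IsFace P F) (hG : IsFace P G)
    (h : G ⊆ F) (hd : dim F ≤ dim G) : G = F := by
  by_contra hne
  have := dim_lt_of_properFace (hG.mono hF.subset h) hne
  omega

theorem dim_pos_iff {F : Set E} : 0 < dim F ↔ ∃ a ∈ F, ∃ b ∈ F, a ≠ b := by
  constructor
  · intro h
    obtain ⟨a, ha⟩ := nonempty_of_dim_nonneg h.le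
    by_contra! hab
    have : F.Subsingleton := fun x hx y hy => hab x hx y hy
    rw [dim_of_nonempty ⟨a, ha⟩, vectorSpan_of_subsingleton ℝ this] at h
    simp at h
  · rintro ⟨a, ha, b, hb, hab⟩
    rw [dim_of_nonempty ⟨a, ha⟩]
    have h1 : a -ᵥ b ∈ vectorSpan ℝ F := vsub_mem_vectorSpan ℝ ha hb
    have h2 : vectorSpan ℝ F ≠ ⊥ := by
      intro h
      rw [h, Submodule.mem_bot, vsub_eq_zero_iff_eq] at h1
      exact hab h1
    have := Nat.pos_of_ne_zero fun h => h2 (Submodule.finrank_eq_zero.1 h)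
    exact_mod_cast this

/-! ### Facets: existence, and facets of facets. -/

/-- A proper face of codimension at least two is contained in a larger proper face. -/
theorem IsFace.exists_larger_properFace {P G : Set E} (hP : IsPolytope P) (hG : IsFace P G)
    (hd : dim G + 1 < dim P) : ∃ G', IsFace P G' ∧ G' ≠ P ∧ G ⊆ G' ∧ dim G < dim G' := by
  rcases G.eq_empty_or_nonempty with rfl | ⟨a, ha⟩
  · rw [dim_empty] at hd
    obtain ⟨a, ha, b, hb, hab⟩ := dim_pos_iff.1 (by simpa using hd)
    obtain ⟨G', h1, h2, h3⟩ := hP.exists_properFace ha hb hab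
    refine ⟨G', h1, h3, Set.empty_subset _, ?_⟩
    have := dim_nonneg h2.ne_empty
    rw [dim_empty]
    omega
  have hGne : G ≠ P := by
    rintro rfl
    omega
  obtain ⟨l, c, hle, hl⟩ := hG.exists_functional ⟨a, ha⟩
  have haP := hG.subset ha
  have hac : l a = c := by
    rw [hl] at ha
    exact ha.2
  have hPn : P.Nonempty := ⟨a, haP⟩
  set W := vectorSpan ℝ P with hW
  set U := vectorSpan ℝ G with hU
  have hUW : U ≤ W := vectorSpan_mono ℝ hG.subset
  have hUl : U ≤ LinearMap.ker l.toLinearMap := by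
    rw [hU, vectorSpan_def, Submodule.span_le]
    rintro _ ⟨p, hp, q, hq, rfl⟩
    rw [hl] at hp hq
    simp [hp.2, hq.2]
  -- By a dimension count, codimension at least two leaves a direction of `P` in the kernel of `l`
  -- but not parallel to `G`. Tilting `l` by a functional that kills `U` and not `w` stays constant
  -- on `G` but cannot become constant on `P`.
  obtain ⟨w, hwW, hwl, hwU⟩ : ∃ w ∈ W, l w = 0 ∧ w ∉ U := by
    by_contra! hcon
    have h1 : W ⊓ LinearMap.ker l.toLinearMap ≤ U := fun w hw => hcon w hw.1 (by simpa using hw.2)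
    have h2 := Submodule.finrank_mono (R := ℝ) h1
    have h3 := Submodule.finrank_sup_add_finrank_inf_eq W (LinearMap.ker l.toLinearMap)
    have h4 := LinearMap.finrank_range_add_finrank_ker l.toLinearMap
    have h5 := Submodule.finrank_le (W ⊔ LinearMap.ker l.toLinearMap)
    have h6 := Submodule.finrank_le (LinearMap.range l.toLinearMap)
    rw [Module.finrank_self] at h6
    rw [dim_of_nonempty ⟨a, ha⟩, dim_of_nonempty hPn, ← hU, ← hW] at hd
    omega
  obtain ⟨m0, hm0w, hm0U⟩ := Submodule.exists_le_ker_of_notMem hwU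
  set m : StrongDual ℝ E := LinearMap.toContinuousLinearMap m0 with hm
  have hmw : m w ≠ 0 := hm0w
  have hmU : ∀ u ∈ U, m u = 0 := fun u hu => hm0U hu
  obtain ⟨S, rfl⟩ := id hP
  have hS : (S : Set E) ⊆ convexHull ℝ (S : Set E) := subset_convexHull ℝ _
  have hWS : ∀ k : StrongDual ℝ E, (∀ v ∈ S, k v = k a) → ∀ u ∈ W, k u = 0 := by
    intro k hk u hu
    have h1 : ∀ p ∈ convexHull ℝ (S : Set E), k p = k a := fun p hp =>
      convexHull_min (t := {p | k p = k a}) hk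
        (convex_hyperplane k.toLinearMap.isLinear (k a)) hp
    have h2 : W ≤ LinearMap.ker k.toLinearMap := by
      rw [hW, vectorSpan_def, Submodule.span_le]
      rintro _ ⟨p, hp, q, hq, rfl⟩
      simp [h1 p hp, h1 q hq]
    simpa using h2 hu
  -- The sign of the tilt is chosen so that it increases at some generator; otherwise `m` would be
  -- constant on `P`.
  obtain ⟨s, hs, v0, hv0, hv0s⟩ : ∃ s : ℝ, s ≠ 0 ∧ ∃ v ∈ S, 0 < s * (m v - m a) := by
    by_contra! hcon
    refine hmw (hWS m (fun v hv => ?_) w hwW)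
    have h1 := hcon 1 one_ne_zero v hv
    have h2 := hcon (-1) (by norm_num) v hv
    linarith
  have hGS : ∀ v ∈ S, l v - c = 0 → s * (m v - m a) = 0 := by
    intro v hv hvc
    have hvG : v ∈ G := by
      rw [hl]
      exact ⟨hS hv, by linarith⟩
    have := hmU _ (vsub_mem_vectorSpan ℝ hvG ha)
    rw [vsub_eq_sub, map_sub] at this
    rw [this, mul_zero]
  obtain ⟨t, ht, hle', v1, hv1, hv1B, hv1t⟩ := exists_tilt S (fun v => l v - c)
    (fun v => s * (m v - m a)) (fun v hv => by linarith [hle v (hS hv)])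
    (fun v hv h => (hGS v hv h).le) ⟨v0, hv0, hv0s⟩
  set k : StrongDual ℝ E := l + (t * s) • m with hk
  have hkv : ∀ p, k p = l p + t * s * m p := fun p => by simp [hk]
  have hkle : ∀ v ∈ (S : Set E), k v ≤ k a := by
    intro v hv
    have := hle' v hv
    rw [hkv, hkv]
    nlinarith
  have hface := isFace_of_forall_le (S := (S : Set E)) k (k a) hkle
  have hsub : G ⊆ {p ∈ convexHull ℝ (S : Set E) | k p = k a} := by
    intro p hp
    refine ⟨hG.subset hp, ?_⟩
    have h1 := hmU _ (vsub_mem_vectorSpan ℝ hp ha)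
    rw [vsub_eq_sub, map_sub, sub_eq_zero] at h1
    rw [hl] at hp
    rw [hkv, hkv, h1, hp.2, hac]
  refine ⟨_, hface, ?_, hsub, ?_⟩
  · intro heq
    have h1 : ∀ v ∈ S, k v = k a := fun v hv => by
      have : v ∈ {p ∈ convexHull ℝ (S : Set E) | k p = k a} := by
        rw [heq]
        exact hS hv
      exact this.2
    have h2 := hWS k h1 w hwW
    rw [hkv, hwl, zero_add] at h2
    exact (mul_ne_zero (mul_ne_zero ht.ne' hs) hmw) h2
  · refine dim_lt_of_properFace (hG.mono hface.subset hsub) fun heq => ?_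
    have hv1' : v1 ∈ G := by
      rw [heq]
      refine ⟨hS hv1, ?_⟩
      rw [hkv, hkv, hac]
      linarith
    rw [hl] at hv1'
    have := hGS v1 hv1 (by linarith [hv1'.2])
    linarith

/-- Every proper face of a polytope is contained in a facet. -/
theorem IsFace.exists_facet {P G : Set E} (hP : IsPolytope P) (hG : IsFace P G) (hne : G ≠ P) :
    ∃ F, IsFacet P F ∧ G ⊆ F := by
  have hfin : {F | IsFace P F ∧ F ≠ P ∧ G ⊆ F}.Finite := hP.finite_faces.subset fun F hF => hF.1
  obtain ⟨F, ⟨hF, hFne, hGF⟩, hmax⟩ :=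
    Set.exists_max_image _ dim hfin ⟨G, hG, hne, subset_rfl⟩
  refine ⟨F, ⟨hF, ?_⟩, hGF⟩
  have h1 := dim_lt_of_properFace hF hFne
  by_contra h2
  obtain ⟨F', hF', hF'ne, hFF', hlt⟩ := hF.exists_larger_properFace hP (by omega)
  have := hmax F' ⟨hF', hF'ne, hGF.trans hFF'⟩
  omega

/-- A proper face of a facet is contained in a second facet. -/
theorem IsFacet.exists_other_facet {P F G : Set E} (hP : IsPolytope P) (hF : IsFacet P F)
    (hG : IsFace F G) (hne : G ≠ F) : ∃ F', IsFacet P F' ∧ F' ≠ F ∧ G ⊆ F' := by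
  suffices h : ∃ G', IsFace P G' ∧ G' ≠ P ∧ G ⊆ G' ∧ ¬ G' ⊆ F by
    obtain ⟨G', hG', hG'ne, hGG', hnot⟩ := h
    obtain ⟨F', hF', hsub⟩ := hG'.exists_facet hP hG'ne
    refine ⟨F', hF', ?_, hGG'.trans hsub⟩
    rintro rfl
    exact hnot hsub
  have hFne := hF.ne
  obtain ⟨v0, hv0, hv0F⟩ := hF.1.exists_vertex_notMem hP hFne
  obtain ⟨u, hu, huG⟩ := hG.exists_vertex_notMem (hF.1.isPolytope hP) hne
  rcases G.eq_empty_or_nonempty with rfl | ⟨a, ha⟩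
  · refine ⟨{v0}, hv0, ?_, Set.empty_subset _, fun h => hv0F (h rfl)⟩
    intro heq
    have : u ∈ ({v0} : Set E) := heq ▸ hF.1.subset (vertices_subset hu)
    rw [Set.mem_singleton_iff] at this
    exact hv0F (this ▸ vertices_subset hu)
  have hGP := hF.1.trans hP hG
  obtain ⟨l, c, hle, hl⟩ := hGP.exists_functional ⟨a, ha⟩
  obtain ⟨m, e, hme, hm⟩ := hF.1.exists_functional ⟨a, hG.subset ha⟩
  obtain ⟨S, rfl⟩ := id hP
  have hS : (S : Set E) ⊆ convexHull ℝ (S : Set E) := subset_convexHull ℝ _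
  -- `e - m v` vanishes on `F` and is positive off it. The tilt thus makes a generator off `F`
  -- tight, while on `F` only `G` stays tight; so `u` remains outside and the new face is proper.
  obtain ⟨t, ht, hle', v1, hv1, hv1B, hv1t⟩ := exists_tilt S (fun v => l v - c)
    (fun v => e - m v) (fun v hv => by linarith [hle v (hS hv)])
    (fun v hv h => by
      have hvG : v ∈ G := by
        rw [hl]
        exact ⟨hS hv, by linarith⟩
      have := hG.subset hvG
      rw [hm] at this
      linarith [this.2])
    ⟨v0, vertices_convexHull_subset hv0, by
      have := hme v0 (vertices_subset hv0)
      refine sub_pos.2 (lt_of_le_of_ne this fun h => hv0F ?_)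
      rw [hm]
      exact ⟨vertices_subset hv0, h⟩⟩
  set k : StrongDual ℝ E := l + (-t) • m with hk
  have hkv : ∀ p, k p = l p - t * m p := fun p => by simp [hk]; ring
  have hface := isFace_of_forall_le (S := (S : Set E)) k (c - t * e) (by
    intro v hv
    have := hle' v hv
    rw [hkv]
    linarith)
  refine ⟨_, hface, ?_, ?_, ?_⟩
  · intro heq
    have huP : u ∈ convexHull ℝ (S : Set E) := hF.1.subset (vertices_subset hu)
    have hu1 := huP
    rw [← heq] at hu1
    have hu2 := vertices_subset hu
    rw [hm] at hu2
    refine huG ?_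
    rw [hl]
    refine ⟨huP, ?_⟩
    have := hu1.2
    rw [hkv, hu2.2] at this
    linarith
  · intro p hp
    have hpF := hG.subset hp
    refine ⟨hGP.subset hp, ?_⟩
    rw [hl] at hp
    rw [hm] at hpF
    rw [hkv, hp.2, hpF.2]
  · intro hsub
    have : v1 ∈ F := hsub ⟨hS hv1, by rw [hkv]; linarith⟩
    rw [hm] at this
    linarith [this.2]

/-- A facet of a facet is the intersection with another facet. -/
theorem IsFacet.eq_inter_of_isFacet {P F G : Set E} (hP : IsPolytope P) (hF : IsFacet P F)
    (hG : IsFacet F G) : ∃ F', IsFacet P F' ∧ F' ≠ F ∧ G = F ∩ F' := by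
  obtain ⟨F', hF', hne, hsub⟩ := hF.exists_other_facet hP hG.1 hG.ne
  refine ⟨F', hF', hne, ?_⟩
  have hface := hF.1.inter hF'.1
  refine hface.eq_of_subset_of_dim_eq (hF.1.trans hP hG.1)
    (Set.subset_inter hG.1.subset hsub) ?_
  have h1 : F ∩ F' ≠ F := by
    intro h
    have h2 : F ⊆ F' := Set.inter_eq_left.1 h
    exact hne (hF'.1.eq_of_subset_of_dim_eq hF.1 h2 (hF'.2.trans hF.2.symm).le).symm
  have := dim_lt_of_properFace (hface.mono hF.1.subset Set.inter_subset_left) h1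
  have := hG.2
  omega

/-- A polytope of dimension `d` has at least `d + 1` vertices. -/
theorem IsPolytope.dim_lt_ncard_vertices {P : Set E} (hP : IsPolytope P) :
    dim P < (vertices P).ncard := by
  rcases P.eq_empty_or_nonempty with rfl | hne
  · rw [dim_empty]
    omega
  obtain ⟨v, hv⟩ := hP.exists_vertex hne
  have hfin := hP.finite_vertices
  have := hfin.to_subtype
  have h1 : vectorSpan ℝ (vertices P) = vectorSpan ℝ P := by
    rw [← direction_affineSpan, ← affineSpan_convexHull, hP.convexHull_vertices,
      direction_affineSpan]
  have hcard : Nat.card (vertices P) ≠ 0 := by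
    rw [Nat.card_coe_set_eq]
    exact ((Set.ncard_pos hfin).2 ⟨v, hv⟩).ne'
  have := Fintype.ofFinite (vertices P)
  have h2 := finrank_vectorSpan_range_le ℝ (fun v : vertices P => (v : E))
    (n := (vertices P).ncard - 1) (by
      rw [← Nat.card_eq_fintype_card]
      rw [Nat.card_coe_set_eq] at hcard ⊢
      omega)
  rw [Subtype.range_coe, h1] at h2
  rw [Nat.card_coe_set_eq] at hcard
  rw [dim_of_nonempty hne]
  omega

end Geometry

/-! ### Combinatorics of the facet index sets. -/

/-- The indices of the vertices of the `i`-th facet of a `d`-dimensional multiplex with vertices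
`x 0, …, x n`. -/
def facetIndices (d n i : ℕ) : Set ℕ :=
  {k | k ≤ n ∧ i < k + d ∧ k < i + d ∧ (k ≠ i ∨ i = 0 ∨ i = n)}

theorem mem_facetIndices {d n i k : ℕ} :
    k ∈ facetIndices d n i ↔ k ≤ n ∧ i < k + d ∧ k < i + d ∧ (k ≠ i ∨ i = 0 ∨ i = n) :=
  Iff.rfl

/-- The increasing enumeration of `facetIndices (e + 1) n i`. -/
def facetEnum (e n i k : ℕ) : ℕ :=
  if 0 < i ∧ i < n ∧ i ≤ i - e + k then i - e + k + 1 else i - e + k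

/-- The largest position in the enumeration of `facetIndices (e + 1) n i`. -/
def facetLast (e n i : ℕ) : ℕ :=
  min n (i + e) - (i - e) - if 0 < i ∧ i < n then 1 else 0

theorem facetEnum_lt_iff {e n i p q : ℕ} : facetEnum e n i p < facetEnum e n i q ↔ p < q := by
  unfold facetEnum
  split_ifs <;> omega

theorem facetEnum_injective (e n i : ℕ) : Function.Injective (facetEnum e n i) := by
  intro p q h
  by_contra hne
  rcases Nat.lt_or_gt_of_ne hne with h' | h'
  · exact absurd h (facetEnum_lt_iff.2 h').ne
  · exact absurd h (facetEnum_lt_iff.2 h').ne'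

/-- Around an interior `i` there are at most `e` labels on each side, so positions more than `e`
apart straddle the omitted `i` and their labels differ by at least `e + 2`. Positions at most `e`
apart gain at most one from the gap. An end facet has only `e + 1` vertices, and both sides hold. -/
theorem facetEnum_le_add_iff {e n i p q : ℕ} (he : e + 1 ≤ n) (hi : i ≤ n)
    (hp : p ≤ facetLast e n i) (hq : q ≤ facetLast e n i) :
    facetEnum e n i q ≤ facetEnum e n i p + (e + 1) ↔ q ≤ p + e := by
  unfold facetEnum
  unfold facetLast at hp hq
  split_ifs at * <;> omega

/-- For `e = 0` an interior index has an empty window, whereas `Set.Iic` always contains 0; `h1`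
excludes this. -/
theorem facetEnum_image {e n i : ℕ} (he : e + 1 ≤ n) (h1 : e = 0 → n = 1) (hi : i ≤ n) :
    facetEnum e n i '' Set.Iic (facetLast e n i) = facetIndices (e + 1) n i := by
  ext k
  simp only [Set.mem_image, Set.mem_Iic, mem_facetIndices]
  constructor
  · rintro ⟨p, hp, rfl⟩
    unfold facetEnum
    unfold facetLast at hp
    split_ifs at * <;> omega
  · intro hk
    unfold facetEnum facetLast
    by_cases h : 0 < i ∧ i < n
    · rcases Nat.lt_or_ge k i with hki | hki
      · refine ⟨k - (i - e), ?_, ?_⟩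
        · rw [if_pos h]; omega
        · rw [if_neg (by omega)]; omega
      · refine ⟨k - (i - e) - 1, ?_, ?_⟩
        · rw [if_pos h]; omega
        · rw [if_pos (by omega)]; omega
    · refine ⟨k - (i - e), ?_, ?_⟩
      · rw [if_neg h]; omega
      · rw [if_neg (by omega)]; omega

theorem facetLast_eq_one {n i : ℕ} (hn : 2 ≤ n) (hi : i ≤ n) : facetLast 1 n i = 1 := by
  unfold facetLast
  split_ifs <;> omega

/-- This and the next two lemmas replace truncated subtraction, `min` and conditionals by linear
alternatives, so that `omega` can treat the expressions as atoms. -/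
theorem lowEnd_cases (e i : ℕ) : i ≤ e ∧ i - e = 0 ∨ i = i - e + e := by omega

theorem facetLast_cases {e n i : ℕ} (h0 : 0 < i) (hin : i < n) :
    n ≤ i + e ∧ n = facetLast e n i + (i - e) + 1 ∨
      i + e < n ∧ i + e = facetLast e n i + (i - e) + 1 ∨ e = 0 := by
  unfold facetLast
  rw [if_pos ⟨h0, hin⟩]
  omega

theorem facetEnum_cases {e n i : ℕ} (h0 : 0 < i) (hin : i < n) (p : ℕ) :
    i - e + p < i ∧ facetEnum e n i p = i - e + p ∨
      i ≤ i - e + p ∧ facetEnum e n i p = i - e + p + 1 := by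
  unfold facetEnum
  split_ifs <;> omega

/-- Every intersection of two facets is contained in some facet of the first one. -/
theorem exists_facetIndices_of_inter {e n i j : ℕ} (he : e + 1 ≤ n) (h1 : e = 0 → n = 1)
    (hi : i ≤ n) (hj : j ≤ n) (hij : j ≠ i) : ∃ k ≤ facetLast e n i, ∀ p ≤ facetLast e n i,
      facetEnum e n i p ∈ facetIndices (e + 1) n j → p ∈ facetIndices e (facetLast e n i) k := by
  by_cases hint : 0 < i ∧ i < n
  · have hlo := lowEnd_cases e i
    have hm := facetLast_cases (e := e) hint.1 hint.2
    -- The index `k` is the position of `j` inside facet `i`, or the first or last position if `j`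
    -- lies beyond the window.
    suffices h : ∃ k ≤ facetLast e n i, (k = 0 ∧ j + e < i ∨ k = facetLast e n i ∧ i + e < j ∨
        j < i ∧ i ≤ j + e ∧ j = i - e + k ∨ i < j ∧ j ≤ i + e ∧ j = i - e + k + 1) by
      obtain ⟨k, hk, hkj⟩ := h
      refine ⟨k, hk, fun p hp => ?_⟩
      have hq := facetEnum_cases (e := e) hint.1 hint.2 p
      simp only [mem_facetIndices]
      generalize facetEnum e n i p = q at *
      generalize facetLast e n i = m at *
      generalize i - e = lo at *
      rintro ⟨hqn, hq1, hq2, hq3⟩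
      rcases hkj with ⟨hk1, hk2⟩ | ⟨hk1, hk2⟩ | ⟨hk1, hk2, hk3⟩ | ⟨hk1, hk2, hk3⟩ <;>
        rcases hlo with ⟨hlo, hlo'⟩ | hlo <;> rcases hm with ⟨hm, hm'⟩ | ⟨hm, hm'⟩ | hm <;>
        rcases hq with ⟨hq, hq'⟩ | ⟨hq, hq'⟩ <;> refine ⟨?_, ?_, ?_, ?_⟩ <;> omega
    by_cases hl : j + e < i
    · exact ⟨0, by omega, by omega⟩
    by_cases hr : i + e < j
    · exact ⟨_, le_rfl, by omega⟩
    rcases Nat.lt_or_gt_of_ne hij with hlt | hgt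
    · exact ⟨j - (i - e), by omega, by omega⟩
    · exact ⟨j - (i - e) - 1, by omega, by omega⟩
  · have hm : facetLast e n i = e := by
      unfold facetLast
      split_ifs <;> omega
    rw [hm]
    have hφ : ∀ p, facetEnum e n i p = i - e + p := fun p => by
      unfold facetEnum
      rw [if_neg (by omega)]
    simp only [hφ, mem_facetIndices]
    -- The facets `i = 0` and `i = n` have `e + 1` vertices. Candidate `k` then omits position `k`,
    -- except that candidates `0` and `e` omit positions `e` and `0` respectively.
    by_cases hl : j + e < n ∧ i = n ∨ j = e ∧ i = 0
    · exact ⟨0, Nat.zero_le _, by omega⟩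
    by_cases hr : i = 0 ∧ e < j ∨ i = n ∧ j = n - e
    · exact ⟨e, le_rfl, by omega⟩
    · exact ⟨j - (i - e), by omega, by omega⟩

/-- Every facet of a facet is the intersection with another facet. -/
theorem exists_inter_eq_facetIndices {e n i k : ℕ} (he : e + 1 ≤ n) (h1 : e = 0 → n = 1)
    (hi : i ≤ n) (hk : k ≤ facetLast e n i) : ∃ j ≤ n, j ≠ i ∧ ∀ p ≤ facetLast e n i,
      (facetEnum e n i p ∈ facetIndices (e + 1) n j ↔ p ∈ facetIndices e (facetLast e n i) k) := by
  by_cases hint : 0 < i ∧ i < n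
  · have hlo := lowEnd_cases e i
    have hm := facetLast_cases (e := e) hint.1 hint.2
    have hqk := facetEnum_cases (e := e) hint.1 hint.2 k
    -- An interior position is cut out by the facet of its own label. The end positions use the
    -- facet whose window stops just short of `i`, or the end facet when `i` is too close to the
    -- boundary.
    suffices h : ∃ j ≤ n, (k = 0 ∧ (j = 0 ∧ i ≤ e ∨ i = j + (e + 1)) ∨
        k = facetLast e n i ∧ (j = n ∧ n ≤ i + e ∨ j = i + (e + 1)) ∨
        0 < k ∧ k < facetLast e n i ∧ j = facetEnum e n i k) by
      obtain ⟨j, hj, hkj⟩ := h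
      refine ⟨j, hj, by omega, fun p hp => ?_⟩
      have hq := facetEnum_cases (e := e) hint.1 hint.2 p
      simp only [mem_facetIndices]
      generalize facetEnum e n i p = q at *
      generalize facetEnum e n i k = r at *
      generalize facetLast e n i = m at *
      generalize i - e = lo at *
      rcases hkj with ⟨hk1, ⟨hk2, hk3⟩ | hk2⟩ | ⟨hk1, ⟨hk2, hk3⟩ | hk2⟩ | ⟨hk1, hk2, hk3⟩ <;>
        rcases hqk with ⟨hqk, hqk'⟩ | ⟨hqk, hqk'⟩ <;>
        rcases hlo with ⟨hlo, hlo'⟩ | hlo <;> rcases hm with ⟨hm, hm'⟩ | ⟨hm, hm'⟩ | hm <;>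
        rcases hq with ⟨hq, hq'⟩ | ⟨hq, hq'⟩ <;> constructor <;> rintro ⟨h4, h5, h6, h7⟩ <;>
        refine ⟨?_, ?_, ?_, ?_⟩ <;> omega
    by_cases h0 : k = 0
    · exact ⟨i - (e + 1), by omega, by omega⟩
    by_cases hkm : k = facetLast e n i
    · exact ⟨min n (i + (e + 1)), by omega, by omega⟩
    · exact ⟨facetEnum e n i k, by omega, by omega⟩
  · have hm : facetLast e n i = e := by
      unfold facetLast
      split_ifs <;> omega
    rw [hm] at hk ⊢
    have hφ : ∀ p, facetEnum e n i p = i - e + p := fun p => by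
      unfold facetEnum
      rw [if_neg (by omega)]
    simp only [hφ, mem_facetIndices]
    by_cases hz : i = 0
    · by_cases hke : k = e
      · exact ⟨e + 1, by omega, by omega, by omega⟩
      by_cases hk0 : k = 0
      · exact ⟨e, by omega, by omega, by omega⟩
      · exact ⟨k, by omega, by omega, by omega⟩
    · by_cases hk0 : k = 0
      · exact ⟨n - e - 1, by omega, by omega, by omega⟩
      by_cases hke : k = e
      · exact ⟨n - e, by omega, by omega, by omega⟩
      · exact ⟨n - e + k, by omega, by omega, by omega⟩

/-- The facets of a multiplex form an antichain. -/
theorem eq_of_facetIndices_subset {d n k l : ℕ} (hd0 : 0 < d) (hd : d ≤ n) (h1 : d = 1 → n = 1)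
    (hk : k ≤ n) (hl : l ≤ n) (h : facetIndices d n k ⊆ facetIndices d n l) : k = l := by
  by_contra hne
  simp only [Set.subset_def, mem_facetIndices] at h
  -- The separating element is the far end of window `k` if it falls outside window `l`, and
  -- otherwise the deleted index `l` itself.
  rcases Nat.lt_or_gt_of_ne hne with hlt | hgt
  · by_cases hdl : d ≤ l
    · have := h (k + 1 - d)
      omega
    · have := h l
      omega
  · by_cases hdl : l + d ≤ n
    · have := h (min n (k + d - 1))
      omega
    · have := h l
      omega

theorem facetIndices_zero (n i : ℕ) : facetIndices 0 n i = ∅ := by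
  ext p
  simp only [mem_facetIndices, Set.mem_empty_iff_false, iff_false]
  omega

/-! ### Multiplexes with ordered vertices, and their faces. -/

section Labelled

variable {E : Type*} [NormedAddCommGroup E] [NormedSpace ℝ E]

/-- `M` is a `d`-dimensional multiplex with ordered vertices `x 0, …, x n`. -/
structure IsLabelledMultiplex (d n : ℕ) (x : ℕ → E) (M : Set E) : Prop where
  isPolytope : IsPolytope M
  dim_eq : dim M = d
  injOn : Set.InjOn x (Set.Iic n)
  image_eq : x '' Set.Iic n = vertices M
  isFacet_iff : ∀ F, IsFacet M F ↔ ∃ i ≤ n, F = convexHull ℝ (x '' facetIndices d n i)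

theorem facetIndices_subset (d n i : ℕ) : facetIndices d n i ⊆ Set.Iic n :=
  fun _ hk => hk.1

end Labelled

namespace IsLabelledMultiplex

variable {E : Type*} [NormedAddCommGroup E] [NormedSpace ℝ E]
  {d n : ℕ} {x : ℕ → E} {M : Set E}

theorem nonempty (h : IsLabelledMultiplex d n x M) : M.Nonempty :=
  nonempty_of_dim_nonneg (by rw [h.dim_eq]; omega)

theorem ncard_vertices (h : IsLabelledMultiplex d n x M) : (vertices M).ncard = n + 1 := by
  rw [← h.image_eq, h.injOn.ncard_image, ← Finset.coe_Iic, Set.ncard_coe_finset, Nat.card_Iic]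

theorem mem_of_le (h : IsLabelledMultiplex d n x M) {k : ℕ} (hk : k ≤ n) : x k ∈ M :=
  vertices_subset (h.image_eq ▸ Set.mem_image_of_mem x hk)

theorem image_subset (h : IsLabelledMultiplex d n x M) {T : Set ℕ} (hT : T ⊆ Set.Iic n) :
    x '' T ⊆ M := by
  rintro _ ⟨k, hk, rfl⟩
  exact h.mem_of_le (hT hk)

theorem mem_convexHull_iff (h : IsLabelledMultiplex d n x M) {T : Set ℕ} (hT : T ⊆ Set.Iic n)
    {k : ℕ} (hk : k ≤ n) : x k ∈ convexHull ℝ (x '' T) ↔ k ∈ T := by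
  constructor
  · intro hx
    obtain ⟨j, hj, hjk⟩ := mem_of_mem_vertices_of_mem_convexHull
      (h.image_eq ▸ Set.mem_image_of_mem x hk) (h.image_subset hT) hx
    exact h.injOn (hT hj) hk hjk ▸ hj
  · exact fun hkT => subset_convexHull ℝ _ (Set.mem_image_of_mem x hkT)

theorem subset_of_image_subset (h : IsLabelledMultiplex d n x M) {S T : Set ℕ}
    (hS : S ⊆ Set.Iic n) (hT : T ⊆ Set.Iic n) (hST : x '' S ⊆ convexHull ℝ (x '' T)) : S ⊆ T :=
  fun _ hk => (h.mem_convexHull_iff hT (hS hk)).1 (hST (Set.mem_image_of_mem x hk))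

theorem isFacet (h : IsLabelledMultiplex d n x M) {i : ℕ} (hi : i ≤ n) :
    IsFacet M (convexHull ℝ (x '' facetIndices d n i)) :=
  (h.isFacet_iff _).2 ⟨i, hi, rfl⟩

theorem vertices_convexHull (h : IsLabelledMultiplex d n x M) {T : Set ℕ} (hT : T ⊆ Set.Iic n)
    (hF : IsFace M (convexHull ℝ (x '' T))) : vertices (convexHull ℝ (x '' T)) = x '' T := by
  rw [hF.vertices_eq h.isPolytope, ← h.image_eq]
  ext v
  constructor
  · rintro ⟨⟨k, hk, rfl⟩, hv⟩
    exact Set.mem_image_of_mem x ((h.mem_convexHull_iff hT hk).1 hv)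
  · rintro ⟨k, hk, rfl⟩
    exact ⟨⟨k, hT hk, rfl⟩, subset_convexHull ℝ _ (Set.mem_image_of_mem x hk)⟩

variable [FiniteDimensional ℝ E]

theorem dim_le (h : IsLabelledMultiplex d n x M) : d ≤ n := by
  have h1 := h.isPolytope.dim_lt_ncard_vertices
  rw [h.dim_eq, h.ncard_vertices] at h1
  omega

/-- For `n ≥ 2` the interior index 1 would give the empty set as a facet, of dimension -1 instead of
0. -/
theorem eq_one (h : IsLabelledMultiplex d n x M) (hd : d = 1) : n = 1 := by
  subst hd
  have h1 := h.dim_le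
  by_contra hne
  have h2 := (h.isFacet (i := 1) h1).2
  have h3 : facetIndices 1 n 1 = ∅ := by
    ext p
    simp only [mem_facetIndices, Set.mem_empty_iff_false, iff_false]
    omega
  rw [h3, h.dim_eq] at h2
  simp [dim_empty] at h2

theorem eq_zero (h : IsLabelledMultiplex d n x M) (hd : d = 0) : n = 0 := by
  subst hd
  by_contra hne
  have h1 : 0 < dim M := dim_pos_iff.2 ⟨x 0, h.mem_of_le (Nat.zero_le _), x n, h.mem_of_le le_rfl,
    fun heq => hne (h.injOn (Set.mem_Iic.2 (Nat.zero_le _)) (Set.mem_Iic.2 le_rfl) heq).symm⟩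
  rw [h.dim_eq] at h1
  omega

theorem face_eq (h : IsLabelledMultiplex d n x M) {F : Set E} (hF : IsFace M F) :
    F = convexHull ℝ (x '' {k | k ≤ n ∧ x k ∈ F}) := by
  conv_lhs => rw [← hF.convexHull_vertices_inter h.isPolytope, ← h.image_eq]
  congr 1
  ext v
  constructor
  · rintro ⟨⟨k, hk, rfl⟩, hv⟩
    exact ⟨k, ⟨hk, hv⟩, rfl⟩
  · rintro ⟨k, ⟨hk, hv⟩, rfl⟩
    exact ⟨⟨k, hk, rfl⟩, hv⟩

/-- Facets of a multiplex are multiplexes, with the induced order of the vertices. -/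
theorem facet {e : ℕ} (h : IsLabelledMultiplex (e + 1) n x M) {i : ℕ} (hi : i ≤ n) :
    IsLabelledMultiplex e (facetLast e n i) (x ∘ facetEnum e n i)
      (convexHull ℝ (x '' facetIndices (e + 1) n i)) := by
  have hP := h.isPolytope
  have hdn := h.dim_le
  have h1 : e = 0 → n = 1 := fun he => h.eq_one (by omega)
  have hF := h.isFacet hi
  have himg := facetEnum_image hdn h1 hi
  have hsub := facetIndices_subset (e + 1) n
  set F := convexHull ℝ (x '' facetIndices (e + 1) n i) with hFdef
  set m := facetLast e n i with hm
  set φ := facetEnum e n i with hφ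
  have hFP := hF.1.isPolytope hP
  have hφn : ∀ p ≤ m, φ p ∈ facetIndices (e + 1) n i := fun p hp =>
    himg ▸ Set.mem_image_of_mem φ (Set.mem_Iic.2 hp)
  have hdim : dim F = e := by
    rw [hF.2, h.dim_eq]
    push_cast
    ring
  have hinj : Set.InjOn (x ∘ φ) (Set.Iic m) := fun p hp q hq hpq =>
    facetEnum_injective e n i (h.injOn (hsub i (hφn p hp)) (hsub i (hφn q hq)) hpq)
  have hvert : (x ∘ φ) '' Set.Iic m = vertices F := by
    rw [Set.image_comp, himg, h.vertices_convexHull (hsub i) hF.1]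
  have hmcard : e ≤ m := by
    have h2 := hFP.dim_lt_ncard_vertices
    rw [hdim, ← hvert, hinj.ncard_image, ← Finset.coe_Iic, Set.ncard_coe_finset, Nat.card_Iic] at h2
    omega
  have hm1 : e = 1 → m = 1 := by
    rintro rfl
    exact facetLast_eq_one hdn hi
  -- the intersection with another facet, in terms of positions
  have hinter : ∀ j ≤ n, F ∩ convexHull ℝ (x '' facetIndices (e + 1) n j) =
      convexHull ℝ ((x ∘ φ) '' {p | p ≤ m ∧ φ p ∈ facetIndices (e + 1) n j}) := by
    intro j hj
    rw [h.face_eq (hF.1.inter (h.isFacet hj).1), Set.image_comp]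
    congr 2
    ext k
    constructor
    · rintro ⟨hk, hkF, hkj⟩
      rw [hFdef, h.mem_convexHull_iff (hsub i) hk, ← himg] at hkF
      rw [h.mem_convexHull_iff (hsub j) hk] at hkj
      obtain ⟨p, hp, rfl⟩ := hkF
      exact ⟨p, ⟨hp, hkj⟩, rfl⟩
    · rintro ⟨p, ⟨hp, hpj⟩, rfl⟩
      have hpn := hsub i (hφn p hp)
      exact ⟨hpn, (h.mem_convexHull_iff (hsub i) hpn).2 (hφn p hp),
        (h.mem_convexHull_iff (hsub j) hpn).2 hpj⟩
  -- the prospective facets are proper faces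
  have hface : ∀ k ≤ m, IsFace F (convexHull ℝ ((x ∘ φ) '' facetIndices e m k)) ∧
      convexHull ℝ ((x ∘ φ) '' facetIndices e m k) ≠ F := by
    intro k hk
    obtain ⟨j, hj, hji, hjk⟩ := exists_inter_eq_facetIndices hdn h1 hi hk
    have h2 : {p | p ≤ m ∧ φ p ∈ facetIndices (e + 1) n j} = facetIndices e m k := by
      ext p
      constructor
      · exact fun hp => (hjk p hp.1).1 hp.2
      · exact fun hp => ⟨hp.1, (hjk p hp.1).2 hp⟩
    rw [← h2, ← hinter j hj]
    refine ⟨(hF.1.inter (h.isFacet hj).1).mono hF.1.subset Set.inter_subset_left, fun heq => ?_⟩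
    have h3 : F ⊆ convexHull ℝ (x '' facetIndices (e + 1) n j) := Set.inter_eq_left.1 heq
    have h4 := h.subset_of_image_subset (hsub i) (hsub j) ((subset_convexHull ℝ _).trans h3)
    exact hji (eq_of_facetIndices_subset (Nat.succ_pos e) hdn (fun he => h.eq_one he) hi hj h4).symm
  -- A facet of `F` is its intersection with another facet of `M`, which lies in some candidate; the
  -- candidate is a proper face, so dimensions force equality.
  have hforward : ∀ G, IsFacet F G → ∃ k ≤ m, G = convexHull ℝ ((x ∘ φ) '' facetIndices e m k) := by
    intro G hG
    obtain ⟨F', hF', hne, rfl⟩ := hF.eq_inter_of_isFacet hP hG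
    obtain ⟨j, hj, rfl⟩ := (h.isFacet_iff F').1 hF'
    have hji : j ≠ i := by
      rintro rfl
      exact hne rfl
    obtain ⟨k, hk, hsubk⟩ := exists_facetIndices_of_inter hdn h1 hi hj hji
    refine ⟨k, hk, ?_⟩
    obtain ⟨hkF, hkne⟩ := hface k hk
    refine hkF.eq_of_subset_of_dim_eq hG.1 ?_ ?_
    · rw [hinter j hj]
      exact convexHull_mono (Set.image_mono fun p hp => hsubk p hp.1 hp.2)
    · have := dim_lt_of_properFace hkF hkne
      have := hG.2
      omega
  refine ⟨hFP, hdim, hinj, hvert, fun G => ⟨hforward G, ?_⟩⟩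
  rintro ⟨k, hk, rfl⟩
  obtain ⟨hkF, hkne⟩ := hface k hk
  -- Conversely a candidate lies in a facet, which is itself a candidate; the antichain property
  -- makes them equal. For `e = 0` all candidates are empty.
  obtain ⟨G, hG, hsubG⟩ := hkF.exists_facet hFP hkne
  obtain ⟨l, hl, rfl⟩ := hforward G hG
  rcases Nat.eq_zero_or_pos e with he | he
  · have h2 : facetIndices e m k = facetIndices e m l := by
      rw [he, facetIndices_zero, facetIndices_zero]
    rw [h2]
    exact hG
  · have h2 : facetIndices e m k ⊆ facetIndices e m l := by
      intro p hp
      have h3 := hsubG (subset_convexHull ℝ _ (Set.mem_image_of_mem (x ∘ φ) hp))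
      obtain ⟨q, hq, hqp⟩ := mem_of_mem_vertices_of_mem_convexHull
        (hvert ▸ Set.mem_image_of_mem (x ∘ φ) (Set.mem_Iic.2 hp.1))
        (by
          rw [← hFP.convexHull_vertices, ← hvert]
          exact (Set.image_mono (facetIndices_subset e m l)).trans (subset_convexHull ℝ _)) h3
      exact hinj hq.1 hp.1 hqp ▸ hq
    rw [eq_of_facetIndices_subset he hmcard hm1 hk hl h2]
    exact hG

/-- Nonempty faces of a multiplex are multiplexes, with the induced order of the vertices, and
the positions within a face determine which vertices are close to each other. -/
theorem face (h : IsLabelledMultiplex d n x M) {G : Set E} (hG : IsFace M G) (hne : G.Nonempty) :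
    ∃ (e m : ℕ) (φ : ℕ → ℕ), IsLabelledMultiplex e m (x ∘ φ) G ∧ Function.Injective φ ∧
      φ '' Set.Iic m = {k | k ≤ n ∧ x k ∈ G} ∧
      ∀ p ≤ m, ∀ q ≤ m, φ q ≤ φ p + d ↔ q ≤ p + e := by
  induction d generalizing n x M with
  | zero =>
    have hGM : G = M := by
      by_contra hGM
      have h1 := dim_lt_of_properFace hG hGM
      have h2 := dim_nonneg hne.ne_empty
      rw [h.dim_eq] at h1
      simp only [Nat.cast_zero] at h1
      omega
    subst hGM
    refine ⟨0, n, id, h, Function.injective_id, ?_, fun p _ q _ => Iff.rfl⟩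
    ext k
    simpa using fun hk => h.mem_of_le hk
  | succ d ih =>
    by_cases hGM : G = M
    · subst hGM
      refine ⟨d + 1, n, id, h, Function.injective_id, ?_, fun p _ q _ => Iff.rfl⟩
      ext k
      simpa using fun hk => h.mem_of_le hk
    obtain ⟨F, hF, hGF⟩ := hG.exists_facet h.isPolytope hGM
    obtain ⟨i, hi, rfl⟩ := (h.isFacet_iff F).1 hF
    obtain ⟨e, m, φ, hlm, hφ, himg, hdist⟩ := ih (h.facet hi) (hG.mono hF.1.subset hGF)
    have hdn := h.dim_le
    have himg' := facetEnum_image hdn (fun he => h.eq_one (by omega)) hi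
    have hφm : ∀ p ≤ m, φ p ≤ facetLast d n i := fun p hp =>
      (himg ▸ Set.mem_image_of_mem φ (Set.mem_Iic.2 hp) :
        φ p ∈ {k | k ≤ facetLast d n i ∧ (x ∘ facetEnum d n i) k ∈ G}).1
    refine ⟨e, m, facetEnum d n i ∘ φ, hlm, (facetEnum_injective d n i).comp hφ, ?_, ?_⟩
    · rw [Set.image_comp, himg]
      ext k
      constructor
      · rintro ⟨p, ⟨hp, hpG⟩, rfl⟩
        have := himg' ▸ Set.mem_image_of_mem (facetEnum d n i) (Set.mem_Iic.2 hp)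
        exact ⟨this.1, hpG⟩
      · rintro ⟨hk, hkG⟩
        have := (h.mem_convexHull_iff (facetIndices_subset _ _ _) hk).1 (hGF hkG)
        rw [← himg'] at this
        obtain ⟨p, hp, rfl⟩ := this
        exact ⟨p, ⟨hp, hkG⟩, rfl⟩
    -- Each facet passed on the way down lowers the diameter bound by one.
    · intro p hp q hq
      rw [← hdist p hp q hq]
      exact facetEnum_le_add_iff hdn hi (hφm p hp) (hφm q hq)

end IsLabelledMultiplex

/-! ### Every multiplex can be labelled. -/

section Labelling

/-- Clamping lets the deleted index reappear only at the ends: `x 0` returns as `x (-1)` and `x n`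
as `x (n + 1)`, which lie in the window because `2 ≤ d`. This is the origin of the last clause of
`facetIndices`. -/
theorem extendList_image_eq {E : Type*} {d n i : ℕ} (hd : 2 ≤ d) (hi : i ≤ n) (x : Fin (n + 1) → E) :
    extendList x '' (Set.Icc ((i : ℤ) - d + 1) ((i : ℤ) + d - 1) \ {(i : ℤ)}) =
      (fun k : ℕ => extendList x k) '' facetIndices d n i := by
  ext v
  constructor
  · rintro ⟨z, ⟨⟨hz1, hz2⟩, hz3⟩, rfl⟩
    rw [Set.mem_singleton_iff] at hz3
    refine ⟨min z.toNat n, ?_, ?_⟩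
    · rw [mem_facetIndices]
      omega
    · simp only [extendList]
      congr 2
      omega
  · rintro ⟨k, hk, rfl⟩
    rw [mem_facetIndices] at hk
    by_cases hki : k = i
    · by_cases hi0 : i = 0
      · refine ⟨-1, ⟨⟨by omega, by omega⟩, by simp [hi0]⟩, ?_⟩
        simp [extendList, hki, hi0]
      · refine ⟨n + 1, ⟨⟨by omega, by omega⟩, by simp; omega⟩, ?_⟩
        have : i = n := by omega
        simp only [extendList]
        congr 2
        omega
    · refine ⟨k, ⟨⟨by omega, by omega⟩, by simp; omega⟩, rfl⟩

variable {E : Type*} [NormedAddCommGroup E] [NormedSpace ℝ E]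

theorem dim_eq_neg_one_iff {F : Set E} : dim F = -1 ↔ F = ∅ := by
  constructor
  · intro h
    by_contra hne
    have := dim_nonneg hne
    omega
  · rintro rfl
    exact dim_empty

variable [FiniteDimensional ℝ E]

theorem dim_eq_zero_iff {F : Set E} : dim F = 0 ↔ ∃ a, F = {a} := by
  constructor
  · intro h
    obtain ⟨a, ha⟩ := nonempty_of_dim_nonneg h.ge
    refine ⟨a, Set.Subset.antisymm (fun b hb => ?_) (Set.singleton_subset_iff.2 ha)⟩
    by_contra hba
    have := dim_pos_iff.2 ⟨b, hb, a, ha, hba⟩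
    omega
  · rintro ⟨a, rfl⟩
    rw [dim_of_nonempty (Set.singleton_nonempty a), vectorSpan_singleton]
    simp

/-- Of three collinear points one lies between the other two, so it cannot be a vertex. -/
theorem IsPolytope.vertices_eq_pair {M : Set E} (hM : IsPolytope M) (hd : dim M = 1) :
    ∃ a b, a ≠ b ∧ vertices M = {a, b} := by
  rw [← Set.ncard_eq_two]
  refine le_antisymm ?_ (by have := hM.dim_lt_ncard_vertices; omega)
  by_contra! hlt
  obtain ⟨a, b, c, ha, hb, hc, hab, hac, hbc⟩ :=
    (Set.two_lt_ncard_iff hM.finite_vertices).1 hlt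
  have hcol : Collinear ℝ M := by
    rw [collinear_iff_finrank_le_one]
    rw [dim_of_nonempty ⟨a, vertices_subset ha⟩] at hd
    omega
  have hbtw : ∀ p ∈ vertices M, ∀ q ∈ vertices M, ∀ r ∈ vertices M, p ≠ q → q ≠ r →
      ¬ Wbtw ℝ p q r := by
    intro p hp q hq r hr hpq hqr h
    have h1 : q ∈ convexHull ℝ ({p, r} : Set E) := by
      rw [convexHull_pair]
      exact h.mem_segment
    have h2 := mem_of_mem_vertices_of_mem_convexHull hq (T := {p, r}) (by
      rintro _ (rfl | rfl)
      · exact vertices_subset hp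
      · exact vertices_subset hr) h1
    rcases h2 with rfl | rfl
    · exact hpq rfl
    · exact hqr rfl
  have hsub : ({a, b, c} : Set E) ⊆ M := by
    rintro _ (rfl | rfl | rfl)
    exacts [vertices_subset ha, vertices_subset hb, vertices_subset hc]
  rcases (hcol.subset hsub).wbtw_or_wbtw_or_wbtw with h | h | h
  · exact hbtw a ha b hb c hc hab hbc h
  · exact hbtw b hb c hc a ha hbc hac.symm h
  · exact hbtw c hc a ha b hb hac.symm hab h

/-- For `d ≤ 1` the definition supplies no list. A point gets `n = 0` with facet `∅`, and a segment
gets `n = 1` with its endpoints as facets. -/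
theorem IsMultiplex.exists_labelling {d : ℕ} {M : Set E} (h : IsMultiplex d M) :
    ∃ (n : ℕ) (x : ℕ → E), IsLabelledMultiplex d n x M := by
  obtain ⟨hM, hd, h⟩ := h
  by_cases hd2 : 2 ≤ d
  · obtain h | ⟨n, x, hinj, hrange, hfacet⟩ := h
    · omega
    refine ⟨n, fun k => extendList x k, hM, hd, ?_, ?_, ?_⟩
    · intro p hp q hq hpq
      have := hinj hpq
      simp only [Fin.mk.injEq, Int.toNat_natCast] at this
      rw [Set.mem_Iic] at hp hq
      omega
    · rw [← hrange]
      ext v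
      constructor
      · rintro ⟨k, -, rfl⟩
        exact ⟨_, rfl⟩
      · rintro ⟨k, rfl⟩
        refine ⟨k, Set.mem_Iic.2 (Nat.lt_succ_iff.1 k.2), ?_⟩
        simp only [extendList]
        congr 1
        ext
        simpa using Nat.lt_succ_iff.1 k.2
    · intro F
      rw [hfacet]
      refine exists_congr fun i => and_congr_right fun hi => ?_
      rw [extendList_image_eq hd2 hi]
  obtain rfl | rfl : d = 0 ∨ d = 1 := by omega
  · obtain ⟨a, rfl⟩ := dim_eq_zero_iff.1 hd
    refine ⟨0, fun _ => a, hM, hd, ?_, ?_, ?_⟩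
    · intro p hp q hq _
      rw [Set.mem_Iic] at hp hq
      omega
    · ext v
      constructor
      · rintro ⟨k, -, rfl⟩
        exact IsFace.refl _
      · intro hv
        exact ⟨0, Set.mem_Iic.2 le_rfl, (vertices_subset hv).symm⟩
    · intro F
      simp only [facetIndices_zero, Set.image_empty, convexHull_empty, IsFacet, hd]
      constructor
      · rintro ⟨-, hF⟩
        exact ⟨0, le_rfl, dim_eq_neg_one_iff.1 (by simpa using hF)⟩
      · rintro ⟨_, _, rfl⟩
        exact ⟨isFace_empty _, by simp [dim_empty]⟩
  · obtain ⟨a, b, hab, hv⟩ := hM.vertices_eq_pair hd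
    have h0 : facetIndices 1 1 0 = {0} := by
      ext k
      rw [mem_facetIndices, Set.mem_singleton_iff]
      constructor
      · omega
      · rintro rfl
        simp
    have h1 : facetIndices 1 1 1 = {1} := by
      ext k
      rw [mem_facetIndices, Set.mem_singleton_iff]
      constructor
      · omega
      · rintro rfl
        simp
    have hpt : ∀ v, IsFacet M {v} ↔ v ∈ vertices M := by
      intro v
      rw [IsFacet, hd, dim_eq_zero_iff.2 ⟨v, rfl⟩, mem_vertices]
      simp
    refine ⟨1, fun k => if k = 0 then a else b, hM, hd, ?_, ?_, ?_⟩
    · intro p hp q hq hpq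
      rw [Set.mem_Iic] at hp hq
      dsimp only at hpq
      split_ifs at hpq
      · omega
      · exact absurd hpq hab
      · exact absurd hpq.symm hab
      · omega
    · rw [hv]
      ext v
      constructor
      · rintro ⟨k, -, rfl⟩
        dsimp only
        split_ifs <;> simp
      · rintro (rfl | rfl)
        · exact ⟨0, by simp, by simp⟩
        · exact ⟨1, by simp, by simp⟩
    · intro F
      constructor
      · intro hF
        obtain ⟨v, rfl⟩ := dim_eq_zero_iff.1 (hF.2.trans (by rw [hd]; simp))
        rw [hpt, hv] at hF
        rcases hF with rfl | rfl
        · exact ⟨0, by simp, by simp [h0]⟩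
        · exact ⟨1, by simp, by simp [h1]⟩
      · rintro ⟨i, hi, rfl⟩
        obtain rfl | rfl : i = 0 ∨ i = 1 := by omega
        · rw [h0]
          simp [hpt, hv]
        · rw [h1]
          simp [hpt, hv]

end Labelling

/-! ### Counting label sets of bounded diameter. -/

/-- The subsets of `{0, …, n}` of diameter at most `d`. -/
def closeSets (d n : ℕ) : Finset (Finset ℕ) :=
  (Finset.range (n + 1)).powerset.filter fun S => ∀ a ∈ S, ∀ b ∈ S, b ≤ a + d

theorem mem_closeSets {d n : ℕ} {S : Finset ℕ} :
    S ∈ closeSets d n ↔ (∀ a ∈ S, a ≤ n) ∧ ∀ a ∈ S, ∀ b ∈ S, b ≤ a + d := by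
  simp [closeSets, Finset.subset_iff]

theorem closeSets_self (d : ℕ) : closeSets d d = (Finset.range (d + 1)).powerset := by
  ext S
  simp only [mem_closeSets, Finset.mem_powerset, Finset.subset_iff, Finset.mem_range,
    Nat.lt_succ_iff]
  exact ⟨fun h => h.1, fun h => ⟨h, fun a ha b hb => (h b hb).trans (Nat.le_add_left _ _)⟩⟩

/-- The new sets are those containing `n + 1`, and the rest of such a set is an arbitrary subset of
the `d` preceding labels. -/
theorem sum_closeSets_succ {R : Type*} [CommRing R] {d n : ℕ} (hd : d ≤ n) (w : ℕ → R) :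
    ∑ S ∈ closeSets d (n + 1), w S.card =
      ∑ S ∈ closeSets d n, w S.card +
        ∑ T ∈ (Finset.Ico (n + 1 - d) (n + 1)).powerset, w (T.card + 1) := by
  have hsplit : closeSets d (n + 1) = closeSets d n ∪
      (Finset.Ico (n + 1 - d) (n + 1)).powerset.image (insert (n + 1)) := by
    ext S
    simp only [Finset.mem_union, Finset.mem_image, Finset.mem_powerset, mem_closeSets]
    constructor
    · rintro ⟨h1, h2⟩
      by_cases hS : n + 1 ∈ S
      · refine Or.inr ⟨S.erase (n + 1), fun a ha => ?_, Finset.insert_erase hS⟩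
        rw [Finset.mem_erase] at ha
        have := h1 a ha.2
        have := h2 a ha.2 _ hS
        rw [Finset.mem_Ico]
        omega
      · refine Or.inl ⟨fun a ha => ?_, h2⟩
        have := h1 a ha
        have : a ≠ n + 1 := fun h => hS (h ▸ ha)
        omega
    · rintro (⟨h1, h2⟩ | ⟨T, hT, rfl⟩)
      · exact ⟨fun a ha => (h1 a ha).trans (Nat.le_succ n), h2⟩
      · have hT' : ∀ a ∈ insert (n + 1) T, n + 1 - d ≤ a ∧ a ≤ n + 1 := by
          intro a ha
          rcases Finset.mem_insert.1 ha with rfl | ha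
          · omega
          · have := Finset.mem_Ico.1 (hT ha)
            omega
        refine ⟨fun a ha => (hT' a ha).2, fun a ha b hb => ?_⟩
        have := hT' a ha
        have := hT' b hb
        omega
  have hnot : ∀ T ∈ (Finset.Ico (n + 1 - d) (n + 1)).powerset, n + 1 ∉ T := by
    intro T hT h
    have := Finset.mem_Ico.1 (Finset.mem_powerset.1 hT h)
    omega
  rw [hsplit, Finset.sum_union, Finset.sum_image]
  · congr 1
    refine Finset.sum_congr rfl fun T hT => ?_
    rw [Finset.card_insert_of_notMem (hnot T hT)]
  · intro T hT T' hT' h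
    rw [← Finset.erase_insert (hnot T hT), ← Finset.erase_insert (hnot T' hT')]
    exact congrArg (fun S => Finset.erase S (n + 1)) h
  · rw [Finset.disjoint_left]
    rintro S hS hS'
    obtain ⟨T, -, rfl⟩ := Finset.mem_image.1 hS'
    have := (mem_closeSets.1 hS).1 (n + 1) (Finset.mem_insert_self _ _)
    omega

/-- The generating function of the sets of diameter at most `d`. -/
theorem sum_closeSets {R : Type*} [CommRing R] (y : R) {d n : ℕ} (hd : d ≤ n) :
    ∑ S ∈ closeSets d n, y ^ (d + 1 - S.card) =
      (y + 1) ^ (d + 1) + ((n : R) - d) * (y + 1) ^ d := by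
  induction n, hd using Nat.le_induction with
  | base =>
    have := Finset.sum_pow_mul_eq_add_pow (1 : R) y (Finset.range (d + 1))
    simp only [one_pow, one_mul, Finset.card_range] at this
    rw [closeSets_self, this, sub_self, zero_mul, add_zero, add_comm]
  | succ n hn ih =>
    have := Finset.sum_pow_mul_eq_add_pow (1 : R) y (Finset.Ico (n + 1 - d) (n + 1))
    simp only [one_pow, one_mul, Nat.card_Ico] at this
    rw [sum_closeSets_succ hn (fun k => y ^ (d + 1 - k)), ih]
    simp only [Nat.add_sub_add_right]
    rw [show n + 1 - (n + 1 - d) = d by omega] at this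
    rw [this]
    push_cast
    ring

open Classical in
/-- The nonempty sets of diameter at most `d` not contained in a facet. -/
noncomputable def fullSets (d n : ℕ) : Finset (Finset ℕ) :=
  (closeSets d n).filter fun S => S.Nonempty ∧ ∀ i ≤ n, ¬ (S : Set ℕ) ⊆ facetIndices d n i

theorem mem_fullSets {d n : ℕ} {S : Finset ℕ} : S ∈ fullSets d n ↔
    S ∈ closeSets d n ∧ S.Nonempty ∧ ∀ i ≤ n, ¬ (S : Set ℕ) ⊆ facetIndices d n i := by
  simp [fullSets]

/-- Let `a` and `b` be the minimum and maximum of such a set `S`. Every label `i` with `b - d < i <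
a + d` must be interior and in `S`, since otherwise facet `i` contains `S`. This forces `S` to be
the interval from `a` to `b`, of length `d` or `d - 1`, the shorter ones avoiding `0` and `n`. -/
theorem fullSets_eq {d n : ℕ} (hd : d ≤ n) (h0 : d = 0 → n = 0) (h1 : d = 1 → n = 1) :
    fullSets d n = (Finset.range (n - d + 1)).image (fun a => Finset.Icc a (a + d)) ∪
      (Finset.Icc 1 (n - d)).image (fun a => Finset.Icc a (a + d - 1)) := by
  ext S
  simp only [mem_fullSets, mem_closeSets, Finset.mem_union, Finset.mem_image, Finset.mem_range,
    Finset.mem_Icc, Set.subset_def, Finset.mem_coe, mem_facetIndices]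
  constructor
  · rintro ⟨⟨hn, hclose⟩, hne, hfull⟩
    set a := S.min' hne with ha
    set b := S.max' hne with hb
    have haS : a ∈ S := S.min'_mem hne
    have hbS : b ∈ S := S.max'_mem hne
    have hab : a ≤ b := S.min'_le b hbS
    have hmin : ∀ c ∈ S, a ≤ c ∧ c ≤ b := fun c hc => ⟨S.min'_le c hc, S.le_max' c hc⟩
    have hbd := hclose a haS b hbS
    have hbn := hn b hbS
    have hmem : ∀ i ≤ n, b < i + d → i < a + d → i ∈ S ∧ i ≠ 0 ∧ i ≠ n := by
      intro i hi h2 h3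
      by_contra hcon
      refine hfull i hi fun c hc => ⟨hn c hc, ?_, ?_, ?_⟩
      · have := hmin c hc
        omega
      · have := hmin c hc
        omega
      · by_contra h4
        have : c = i := by omega
        subst this
        exact hcon ⟨hc, by omega, by omega⟩
    have hb0 : 0 < d → d ≤ b := by
      intro hd0
      by_contra h2
      exact (hmem 0 (Nat.zero_le _) (by omega) (by omega)).2.1 rfl
    have han : a + d ≤ n := by
      rcases Nat.eq_zero_or_pos d with h2 | h2
      · omega
      · by_contra h3
        exact (hmem n le_rfl (by omega) (by omega)).2.2 rfl
    have hIcc : ∀ c, b = a + d ∨ b + 1 = a + d → (a ≤ c ∧ c ≤ b ↔ c ∈ S) := by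
      intro c hcase
      refine ⟨fun hc => ?_, hmin c⟩
      by_cases hca : c = a
      · exact hca ▸ haS
      by_cases hcb : c = b
      · exact hcb ▸ hbS
      exact (hmem c (by omega) (by omega) (by omega)).1
    by_cases hba : b = a + d
    · refine Or.inl ⟨a, by omega, ?_⟩
      ext c
      rw [Finset.mem_Icc, ← hIcc c (Or.inl hba), hba]
    · have hba' : b + 1 = a + d := by
        by_contra h2
        -- If the interval were any shorter, this label would be forced into `S` although it lies
        -- below the minimum.
        have h3 := hmem (b + 1 - d) (by omega) (by omega) (by omega)
        have := hmin _ h3.1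
        omega
      refine Or.inr ⟨a, by omega, ?_⟩
      ext c
      rw [Finset.mem_Icc, ← hIcc c (Or.inr hba')]
      omega
  · rintro (⟨a, ha, rfl⟩ | ⟨a, ha, rfl⟩)
    · simp only [Finset.mem_Icc, Finset.nonempty_Icc]
      refine ⟨⟨fun c hc => by omega, fun b hb c hc => by omega⟩, by omega, fun i hi h => ?_⟩
      have h2 := h a
      have h3 := h (a + d)
      have h4 := h i
      omega
    · simp only [Finset.mem_Icc, Finset.nonempty_Icc]
      refine ⟨⟨fun c hc => by omega, fun b hb c hc => by omega⟩, by omega, fun i hi h => ?_⟩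
      have h2 := h a
      have h3 := h (a + d - 1)
      have h4 := h i
      omega

theorem sum_fullSets {R : Type*} [CommRing R] {d n : ℕ} (hd : d ≤ n) (h0 : d = 0 → n = 0)
    (h1 : d = 1 → n = 1) (w : ℕ → R) :
    ∑ S ∈ fullSets d n, w S.card = ((n : R) - d + 1) * w (d + 1) + ((n : R) - d) * w d := by
  have hinj : ∀ {a b c e : ℕ}, a ≤ b → Finset.Icc a b = Finset.Icc c e → a = c := by
    intro a b c e hab h
    simp only [Finset.ext_iff, Finset.mem_Icc] at h
    have h2 := h a
    have h3 := h c
    omega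
  rw [fullSets_eq hd h0 h1, Finset.sum_union, Finset.sum_image, Finset.sum_image]
  · have e1 : ∀ a, (Finset.Icc a (a + d)).card = d + 1 := fun a => by
      rw [Nat.card_Icc]; omega
    have e2 : ∑ a ∈ Finset.Icc 1 (n - d), w (Finset.Icc a (a + d - 1)).card =
        ∑ _a ∈ Finset.Icc 1 (n - d), w d := by
      refine Finset.sum_congr rfl fun a ha => ?_
      rw [Finset.mem_Icc] at ha
      rw [Nat.card_Icc]
      congr 1
      omega
    rw [e2]
    simp only [e1, Finset.sum_const, Finset.card_range, Nat.card_Icc, nsmul_eq_mul,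
      Nat.add_sub_cancel]
    push_cast [Nat.cast_sub hd]
    ring
  · intro a ha b hb hab
    rw [Finset.mem_coe, Finset.mem_Icc] at ha
    exact hinj (b := a + d - 1) (by omega) hab
  · intro a ha b hb hab
    exact hinj (b := a + d) (by omega) hab
  · rw [Finset.disjoint_left]
    intro S hS hS'
    obtain ⟨a, -, rfl⟩ := Finset.mem_image.1 hS
    obtain ⟨b, hb, hab⟩ := Finset.mem_image.1 hS'
    rw [Finset.mem_Icc] at hb
    have := congrArg Finset.card hab
    rw [Nat.card_Icc, Nat.card_Icc] at this
    omega

/-! ### Carriers and the toric polynomials of a multiplex. -/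

section Toric

variable {E : Type*} [NormedAddCommGroup E] [NormedSpace ℝ E]

/-- The number of vertices in excess of those of a simplex of the same dimension. -/
noncomputable def vertexExcess (G : Set E) : ℤ :=
  ((vertices G).ncard : ℤ) - 1 - dim G

theorem vertices_empty : vertices (∅ : Set E) = ∅ :=
  Set.subset_empty_iff.1 vertices_subset

theorem vertexExcess_empty : vertexExcess (∅ : Set E) = 0 := by
  simp [vertexExcess, vertices_empty, dim_empty]

theorem IsLabelledMultiplex.vertexExcess_eq {d n : ℕ} {x : ℕ → E} {M : Set E}
    (h : IsLabelledMultiplex d n x M) : vertexExcess M = (n : ℤ) - d := by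
  rw [vertexExcess, h.ncard_vertices, h.dim_eq]
  push_cast
  ring

/-- `G` is the smallest face of `P` containing `T`. -/
def IsCarrier (P T G : Set E) : Prop :=
  IsFace P G ∧ T ⊆ G ∧ ∀ G', IsFace P G' → T ⊆ G' → G ⊆ G'

theorem IsCarrier.unique {P T G G' : Set E} (h : IsCarrier P T G) (h' : IsCarrier P T G') :
    G = G' :=
  Set.Subset.antisymm (h.2.2 G' h'.1 h'.2.1) (h'.2.2 G h.1 h.2.1)

theorem isCarrier_empty_iff {P T : Set E} : IsCarrier P T ∅ ↔ T = ∅ :=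
  ⟨fun h => Set.subset_empty_iff.1 h.2.1,
    fun h => ⟨isFace_empty P, h.subset, fun _ _ _ => Set.empty_subset _⟩⟩

/-- The linear polynomial `1 + (f₀(G) - dim G - 1) x`, the toric `g`-polynomial of a multiplex. -/
noncomputable def linearG (G : Set E) : ℤ[X] :=
  1 + C (vertexExcess G) * X

theorem linearG_empty : linearG (∅ : Set E) = 1 := by
  simp [linearG, vertexExcess_empty]

variable [FiniteDimensional ℝ E]

theorem IsPolytope.exists_isCarrier {P T : Set E} (hP : IsPolytope P) (hT : T ⊆ P) :
    ∃ G, IsCarrier P T G := by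
  have hfin : {G | IsFace P G ∧ T ⊆ G}.Finite := hP.finite_faces.subset fun G hG => hG.1
  obtain ⟨G, ⟨hG, hTG⟩, hmin⟩ := Set.exists_min_image _ dim hfin ⟨P, IsFace.refl P, hT⟩
  refine ⟨G, hG, hTG, fun G' hG' hTG' => ?_⟩
  exact Set.inter_eq_left.1 (hG.eq_of_subset_of_dim_eq (hG.inter hG') Set.inter_subset_left
    (hmin _ ⟨hG.inter hG', Set.subset_inter hTG hTG'⟩))

open Classical in
/-- The sum over the sets of diameter at most `d` with a given carrier. -/
theorem IsLabelledMultiplex.sum_isCarrier {R : Type*} [CommRing R] {d n : ℕ} {x : ℕ → E}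
    {M G : Set E} (h : IsLabelledMultiplex d n x M) (hG : IsFace M G) (hne : G.Nonempty)
    (w : ℕ → R) :
    ∑ S ∈ (closeSets d n).filter (fun S : Finset ℕ => IsCarrier M (x '' (S : Set ℕ)) G), w S.card =
      ((vertexExcess G : ℤ) + 1 : R) * w ((dim G).toNat + 1) +
        (vertexExcess G : ℤ) * w (dim G).toNat := by
  obtain ⟨e, m, φ, hlm, hφ, himg, hdist⟩ := h.face hG hne
  have hP := h.isPolytope
  have hφm : ∀ p ≤ m, φ p ≤ n ∧ x (φ p) ∈ G := fun p hp =>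
    himg.subset (Set.mem_image_of_mem φ (Set.mem_Iic.2 hp))
  -- A set has carrier `G` exactly when it lies in `G`, is nonempty and lies in no facet of `G`;
  -- `hdist` turns diameter `d` in `M` into diameter `e` in positions of `G`.
  have hset : (closeSets d n).filter (fun S : Finset ℕ => IsCarrier M (x '' (S : Set ℕ)) G) =
      (fullSets e m).image (Finset.image φ) := by
    ext S
    rw [Finset.mem_filter, Finset.mem_image]
    constructor
    · rintro ⟨hS, -, hSG, hmin⟩
      rw [mem_closeSets] at hS
      have hSφ : ∀ k ∈ S, ∃ p ≤ m, φ p = k := by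
        intro k hk
        have : k ∈ φ '' Set.Iic m := by
          rw [himg]
          exact ⟨hS.1 k hk, hSG (Set.mem_image_of_mem x hk)⟩
        exact this
      have hSimg : ((Finset.range (m + 1)).filter (φ · ∈ S)).image φ = S := by
        ext k
        simp only [Finset.mem_image, Finset.mem_filter, Finset.mem_range, Nat.lt_succ_iff]
        constructor
        · rintro ⟨p, ⟨-, hp⟩, rfl⟩
          exact hp
        · intro hk
          obtain ⟨p, hp, rfl⟩ := hSφ k hk
          exact ⟨p, ⟨hp, hk⟩, rfl⟩
      have hmem : ∀ p, p ∈ (Finset.range (m + 1)).filter (φ · ∈ S) ↔ p ≤ m ∧ φ p ∈ S := by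
        intro p
        rw [Finset.mem_filter, Finset.mem_range, Nat.lt_succ_iff]
      refine ⟨_, ?_, hSimg⟩
      rw [mem_fullSets, mem_closeSets]
      refine ⟨⟨fun p hp => ((hmem p).1 hp).1, fun p hp q hq => ?_⟩, ?_, fun i hi hsub => ?_⟩
      · rw [hmem] at hp hq
        exact (hdist p hp.1 q hq.1).1 (hS.2 _ hp.2 _ hq.2)
      · rw [← Finset.image_nonempty (f := φ), hSimg]
        by_contra hemp
        rw [Finset.not_nonempty_iff_eq_empty] at hemp
        obtain ⟨a, ha⟩ := hne
        exact hmin ∅ (isFace_empty M) (by simp [hemp]) ha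
      · have hF := hlm.isFacet hi
        refine hF.ne (Set.Subset.antisymm hF.1.subset (hmin _ (hG.trans hP hF.1) ?_))
        rintro _ ⟨k, hk, rfl⟩
        obtain ⟨p, hp, rfl⟩ := hSφ k hk
        exact subset_convexHull ℝ _ (Set.mem_image_of_mem (x ∘ φ)
          (hsub (Finset.mem_coe.2 ((hmem p).2 ⟨hp, hk⟩))))
    · rintro ⟨T, hT, rfl⟩
      rw [mem_fullSets, mem_closeSets] at hT
      obtain ⟨⟨hTm, hTe⟩, -, hfull⟩ := hT
      refine ⟨?_, hG, ?_, fun G' hG' hsub => ?_⟩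
      · simp only [mem_closeSets, Finset.forall_mem_image]
        exact ⟨fun p hp => (hφm p (hTm p hp)).1, fun p hp q hq =>
          (hdist p (hTm p hp) q (hTm q hq)).2 (hTe p hp q hq)⟩
      · rw [Finset.coe_image, ← Set.image_comp]
        rintro _ ⟨p, hp, rfl⟩
        exact (hφm p (hTm p hp)).2
      · by_contra hnot
        obtain ⟨F, hF, hGF⟩ := IsFace.exists_facet (G := G ∩ G') (hG.isPolytope hP)
          ((hG.inter hG').mono hG.subset Set.inter_subset_left)
          (fun heq => hnot (Set.inter_eq_left.1 heq))
        obtain ⟨i, hi, rfl⟩ := (hlm.isFacet_iff F).1 hF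
        refine hfull i hi fun p hp => ?_
        rw [← hlm.mem_convexHull_iff (facetIndices_subset _ _ _) (hTm p hp)]
        refine hGF ⟨(hφm p (hTm p hp)).2, hsub ?_⟩
        rw [Finset.coe_image, ← Set.image_comp]
        exact Set.mem_image_of_mem (x ∘ φ) hp
  rw [hset, Finset.sum_image (Finset.image_injective hφ).injOn]
  simp only [Finset.card_image_of_injective _ hφ]
  rw [sum_fullSets hlm.dim_le (fun he => hlm.eq_zero he) (fun he => hlm.eq_one he),
    hlm.vertexExcess_eq, hlm.dim_eq]
  push_cast
  simp

open Classical in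
-- Double count of the close sets: directly by `sum_closeSets` with `y = X - 1`, and by carrier,
-- where a face contributes its own summand.
theorem IsLabelledMultiplex.sum_linearG {d n : ℕ} {x : ℕ → E} {M : Set E}
    (h : IsLabelledMultiplex d n x M) :
    ∑ G ∈ h.isPolytope.finite_faces.toFinset, linearG G * (X - 1) ^ ((d : ℤ) - dim G).toNat =
      X ^ (d + 1) + C ((n : ℤ) - d) * X ^ d := by
  have hP := h.isPolytope
  have hcar : ∀ S ∈ closeSets d n, ∃ G, IsCarrier M (x '' (S : Set ℕ)) G := fun S hS =>
    hP.exists_isCarrier (h.image_subset fun k hk => (mem_closeSets.1 hS).1 k hk)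
  choose! f hf using hcar
  have hsum := sum_closeSets (X - 1 : ℤ[X]) h.dim_le
  rw [sub_add_cancel] at hsum
  rw [show (X ^ (d + 1) + C ((n : ℤ) - d) * X ^ d : ℤ[X]) =
    X ^ (d + 1) + ((n : ℤ[X]) - (d : ℤ[X])) * X ^ d by simp, ← hsum,
    ← Finset.sum_fiberwise_of_maps_to (g := f) (t := hP.finite_faces.toFinset)
      (fun S hS => by simpa using (hf S hS).1)]
  refine Finset.sum_congr rfl fun G hG => ?_
  rw [Set.Finite.mem_toFinset] at hG
  have hG' : IsFace M G := hG
  have hfilter : (closeSets d n).filter (fun S => f S = G) =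
      (closeSets d n).filter (fun S : Finset ℕ => IsCarrier M (x '' (S : Set ℕ)) G) := by
    refine Finset.filter_congr fun S hS => ⟨?_, fun hS' => (hf S hS).unique hS'⟩
    rintro rfl
    exact hf S hS
  rw [hfilter]
  rcases G.eq_empty_or_nonempty with rfl | hne
  · have : (closeSets d n).filter (fun S : Finset ℕ => IsCarrier M (x '' (S : Set ℕ)) ∅) = {∅} := by
      ext S
      rw [Finset.mem_filter, isCarrier_empty_iff, Set.image_eq_empty, Finset.coe_eq_empty,
        Finset.mem_singleton]
      refine ⟨fun h => h.2, ?_⟩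
      rintro rfl
      exact ⟨by simp [mem_closeSets], rfl⟩
    rw [this, Finset.sum_singleton, linearG_empty, dim_empty, Finset.card_empty, one_mul]
    congr 1
  · rw [h.sum_isCarrier hG' hne (fun k => (X - 1 : ℤ[X]) ^ (d + 1 - k))]
    have hd0 := dim_nonneg hne.ne_empty
    have hdd : dim G ≤ d := by
      rw [← h.dim_eq]
      by_cases hGM : G = M
      · rw [hGM]
      · exact (dim_lt_of_properFace hG' hGM).le
    obtain ⟨e, he⟩ := Int.eq_ofNat_of_zero_le hd0
    rw [he] at hdd ⊢
    obtain ⟨c, hc⟩ := Nat.exists_eq_add_of_le (Int.ofNat_le.1 hdd)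
    rw [show ((d : ℤ) - (e : ℤ)).toNat = c by omega, Int.toNat_natCast,
      show d + 1 - (e + 1) = c by omega, show d + 1 - e = c + 1 by omega, linearG]
    simp only [eq_intCast]
    ring

open Classical in
theorem toricH_eq_sum {P : Set E} (hP : IsPolytope P) (hne : P.Nonempty) :
    toricH P = ∑ G ∈ hP.finite_faces.toFinset.erase P,
      toricG G * (X - 1) ^ (dim P - 1 - dim G).toNat := by
  rw [toricH_eq hne.ne_empty]
  have h1 := finsum_set_coe_eq_finsum_mem (M := ℤ[X])
    (f := fun G => toricG G * (X - 1) ^ (dim P - 1 - dim G).toNat) {G | IsFace P G ∧ G ≠ P}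
  refine h1.trans ?_
  rw [finsum_mem_eq_finite_toFinset_sum _ (hP.finite_faces.subset fun G hG => hG.1)]
  refine Finset.sum_congr ?_ fun _ _ => rfl
  ext G
  simp [and_comm]

/-- The `h`-polynomial of a multiplex. -/
theorem IsLabelledMultiplex.toricH_eq {d n : ℕ} {x : ℕ → E} {M : Set E}
    (h : IsLabelledMultiplex d n x M)
    (hg : ∀ G, IsFace M G → G ≠ M → toricG G = linearG G) :
    toricH M = ∑ i ∈ Finset.range (d + 1), X ^ i +
      C ((n : ℤ) - d) * (X * ∑ i ∈ Finset.range (d - 1), X ^ i) := by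
  classical
  have hP := h.isPolytope
  have hsum := h.sum_linearG
  rw [← Finset.add_sum_erase _ _ (a := M) (by simpa using IsFace.refl M)] at hsum
  have hH : toricH M * (X - 1) = ∑ G ∈ hP.finite_faces.toFinset.erase M,
      linearG G * (X - 1) ^ ((d : ℤ) - dim G).toNat := by
    rw [toricH_eq_sum hP h.nonempty, Finset.sum_mul]
    refine Finset.sum_congr rfl fun G hG => ?_
    rw [Finset.mem_erase, Set.Finite.mem_toFinset] at hG
    have hlt := dim_lt_of_properFace hG.2 hG.1
    rw [hg G hG.2 hG.1, mul_assoc, ← pow_succ, ← h.dim_eq]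
    congr 2
    omega
  rw [← hH, h.dim_eq, sub_self, Int.toNat_zero, pow_zero, mul_one, linearG,
    h.vertexExcess_eq] at hsum
  have hX : (X - 1 : ℤ[X]) ≠ 0 := X_sub_C_ne_zero (1 : ℤ)
  -- With the term of `M` itself removed, what remains to divide by `X - 1` is `(X ^ (d + 1) - 1) +
  -- (n - d) * (X ^ d - X)`. At `d = 0` the truncated `d - 1` is harmless because `n - d = 0`.
  refine mul_right_cancel₀ hX ?_
  rw [add_mul, geom_sum_mul, mul_assoc, mul_assoc, geom_sum_mul]
  rcases Nat.eq_zero_or_pos d with hd | hd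
  · have hn := h.eq_zero hd
    subst hd hn
    simp only [Nat.cast_zero, sub_self, map_zero, zero_mul, add_zero] at hsum ⊢
    linear_combination hsum
  · obtain ⟨c, rfl⟩ := Nat.exists_eq_add_of_lt hd
    rw [show 0 + c + 1 - 1 = c by omega]
    rw [show 0 + c + 1 = c + 1 by omega] at hsum ⊢
    linear_combination hsum

/-- The `g`-polynomial obtained from the `h`-polynomial of a multiplex. -/
theorem gOfH_multiplex {d : ℕ} {c : ℤ} (hc : d ≤ 1 → c = 0) :
    gOfH d (∑ i ∈ Finset.range (d + 1), X ^ i +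
      C c * (X * ∑ i ∈ Finset.range (d - 1), X ^ i)) = 1 + C c * X := by
  set H : ℤ[X] := ∑ i ∈ Finset.range (d + 1), X ^ i +
      C c * (X * ∑ i ∈ Finset.range (d - 1), X ^ i) with hH
  have htop : H.coeff d = 1 := by
    rcases Nat.eq_zero_or_pos d with rfl | hd
    · simp [hH]
    · obtain ⟨b, rfl⟩ := Nat.exists_eq_add_of_lt hd
      simp [hH, coeff_X_pow]
  have hmid : ∀ k, 1 ≤ k → k < d → H.coeff k = 1 + c := by
    intro k hk hkd
    obtain ⟨b, rfl⟩ := Nat.exists_eq_add_of_le hk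
    rw [hH, coeff_add, coeff_C_mul, add_comm 1 b, coeff_X_mul]
    simp only [finsetSum_coeff, coeff_X_pow, Finset.sum_ite_eq, Finset.mem_range]
    rw [if_pos (by omega), if_pos (by omega), mul_one]
  unfold gOfH hCoeff
  by_cases hd : d ≤ 1
  · rw [show d / 2 + 1 = 1 by omega, hc hd]
    simp [htop]
  -- The coefficients are `1, 1 + c, …, 1 + c, 1`, so successive differences vanish from index 2 up
  -- to `d / 2`.
  · rw [← Finset.sum_subset (s₁ := Finset.range 2)]
    · simp only [Finset.sum_range_succ, Finset.range_zero, Finset.sum_empty, if_true, pow_zero,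
        one_ne_zero, if_false, Nat.sub_self, Nat.sub_zero, htop, hmid (d - 1) (by omega) (by omega)]
      simp
    · intro i hi
      rw [Finset.mem_range] at hi ⊢
      omega
    · intro i hi hi'
      rw [Finset.mem_range] at hi hi'
      rw [if_neg (by omega), hmid (d - i) (by omega) (by omega),
        hmid (d - (i - 1)) (by omega) (by omega)]
      simp

/-- The `g`-polynomial of a multiplex. -/
theorem IsLabelledMultiplex.toricG_eq {d n : ℕ} {x : ℕ → E} {M : Set E}
    (h : IsLabelledMultiplex d n x M) : toricG M = linearG M := by
  induction d using Nat.strong_induction_on generalizing n x M with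
  | _ d ih =>
    have hg : ∀ G, IsFace M G → G ≠ M → toricG G = linearG G := by
      intro G hG hGM
      rcases G.eq_empty_or_nonempty with rfl | hne
      · rw [toricG_empty, linearG_empty]
      obtain ⟨e, m, φ, hlm, -⟩ := h.face hG hne
      have hlt := dim_lt_of_properFace hG hGM
      rw [hlm.dim_eq, h.dim_eq] at hlt
      exact ih e (by omega) hlm
    rw [toricG, h.toricH_eq hg, h.dim_eq, Int.toNat_natCast, gOfH_multiplex, linearG,
      h.vertexExcess_eq]
    intro hd
    rcases Nat.le_one_iff_eq_zero_or_eq_one.1 hd with hd | hd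
    · rw [h.eq_zero hd, hd]; simp
    · rw [h.eq_one hd, hd]; simp

end Toric

/-! ### Face numbers and the formula for multiplicial polytopes. -/

section FaceNumbers

variable {E : Type*} [NormedAddCommGroup E] [NormedSpace ℝ E]

open Classical in
/-- The faces of `P` of dimension `j`. -/
noncomputable def facesOfDim {P : Set E} (hP : IsPolytope P) (j : ℤ) : Finset (Set E) :=
  hP.finite_faces.toFinset.filter fun G => dim G = j

theorem mem_facesOfDim {P : Set E} (hP : IsPolytope P) {j : ℤ} {G : Set E} :
    G ∈ facesOfDim hP j ↔ IsFace P G ∧ dim G = j := by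
  simp [facesOfDim]

theorem fNum_eq {P : Set E} (hP : IsPolytope P) (j : ℤ) : fNum P j = (facesOfDim hP j).card := by
  rw [fNum, ← Set.ncard_coe_finset]
  congr 1
  ext G
  rw [Finset.mem_coe, mem_facesOfDim, Set.mem_ofPred_eq]

theorem fZeroNum_eq {P : Set E} (hP : IsPolytope P) (j : ℤ) :
    fZeroNum P j = ∑ G ∈ facesOfDim hP j, (vertices G).ncard := by
  have hset : {F : Set E | IsFace P F ∧ dim F = j} = facesOfDim hP j := by
    ext G
    rw [Finset.mem_coe, mem_facesOfDim, Set.mem_ofPred_eq]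
  have h1 := finsum_set_coe_eq_finsum_mem (f := fun G : Set E => (vertices G).ncard)
    {F : Set E | IsFace P F ∧ dim F = j}
  refine h1.trans ?_
  rw [hset, finsum_mem_coe_finset]

theorem excess_eq {P : Set E} (hP : IsPolytope P) (j : ℤ) :
    excess P j = ∑ G ∈ facesOfDim hP j, vertexExcess G := by
  have h1 : ∀ G ∈ facesOfDim hP j, vertexExcess G = (vertices G).ncard - (1 + j) := by
    intro G hG
    rw [vertexExcess, ((mem_facesOfDim hP).1 hG).2]
    ring
  rw [excess, fZeroNum_eq hP, fNum_eq hP, Finset.sum_congr rfl h1, Finset.sum_sub_distrib,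
    Finset.sum_const, nsmul_eq_mul]
  push_cast
  ring

theorem fNum_neg_one {P : Set E} : fNum P (-1) = 1 := by
  rw [fNum, Set.ncard_eq_one]
  refine ⟨∅, ?_⟩
  ext G
  rw [Set.mem_ofPred_eq, dim_eq_neg_one_iff, Set.mem_singleton_iff]
  refine ⟨fun h => h.2, ?_⟩
  rintro rfl
  exact ⟨isFace_empty P, rfl⟩

variable [FiniteDimensional ℝ E]

theorem IsMultiplicial.toricG_face {d : ℕ} {P G : Set E} (h : IsMultiplicial d P)
    (hG : IsFace P G) (hne : G ≠ P) : toricG G = linearG G := by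
  by_cases hG0 : G = ∅
  · rw [hG0, toricG_empty, linearG_empty]
  obtain ⟨e, he⟩ := h.2.2 G hG hG0 hne
  obtain ⟨n, x, hx⟩ := he.exists_labelling
  exact hx.toricG_eq

/-- The empty face, points and segments have no excess; `j < d` keeps `P` itself out of the sum. -/
theorem IsMultiplicial.excess_eq_zero {d : ℕ} {P : Set E} (h : IsMultiplicial d P) {j : ℤ}
    (hj : j ≤ 1) (hjd : j < d) : excess P j = 0 := by
  rw [excess_eq h.1]
  refine Finset.sum_eq_zero fun G hG => ?_
  rw [mem_facesOfDim] at hG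
  by_cases hG0 : G = ∅
  · rw [hG0, vertexExcess_empty]
  have hne : G ≠ P := by
    rintro rfl
    have := h.2.1
    omega
  obtain ⟨e, he⟩ := h.2.2 G hG.1 hG0 hne
  obtain ⟨n, x, hx⟩ := he.exists_labelling
  have hdim := hx.dim_eq
  rw [hx.vertexExcess_eq]
  obtain rfl | rfl : e = 0 ∨ e = 1 := by omega
  · rw [hx.eq_zero rfl, sub_self]
  · rw [hx.eq_one rfl, sub_self]

/-- The modified face numbers in terms of the face numbers and the excess vertex counts. -/
theorem IsMultiplicial.fBar_eq {d i : ℕ} {P : Set E} (h : IsMultiplicial d P) (hi : i ≤ d) :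
    fBar P ((i : ℤ) - 1) = fNum P ((i : ℤ) - 1) + excess P ((i : ℤ) - 1) +
      if i < d then excess P i else 0 := by
  unfold fBar
  rw [h.2.1]
  -- The special cases of `fBar` fit one formula, because excesses in dimension at most 1 vanish and
  -- the last summand is dropped when it would refer to `P` itself.
  rcases Nat.eq_zero_or_pos i with rfl | hi0
  · rw [if_pos (by simp)]
    simp only [Nat.cast_zero, zero_sub, fNum_neg_one]
    rw [h.excess_eq_zero (by norm_num) (by omega)]
    split_ifs with hd
    · rw [h.excess_eq_zero (by norm_num) (by omega)]
      simp
    · simp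
  rw [if_neg (by omega)]
  by_cases hi1 : i = 1
  · subst hi1
    rw [if_pos (by simp)]
    simp only [Nat.cast_one, sub_self]
    rw [h.excess_eq_zero (by norm_num) (by omega)]
    split_ifs with hd
    · rw [h.excess_eq_zero (by norm_num) (by omega)]
      simp
    · simp
  rw [if_neg (by omega)]
  by_cases hid : i = d
  · subst hid
    simp
  · rw [if_neg (by omega), if_pos (by omega), sub_add_cancel]
    ring

theorem IsMultiplicial.toricH_eq_sum_dim {d : ℕ} {P : Set E} (h : IsMultiplicial d P) :
    toricH P = ∑ i ∈ Finset.range (d + 1),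
      (C (fNum P ((i : ℤ) - 1) : ℤ) + C (excess P ((i : ℤ) - 1)) * X) * (X - 1) ^ (d - i) := by
  classical
  have hP := h.1
  have hne : P.Nonempty := nonempty_of_dim_nonneg (by rw [h.2.1]; omega)
  rw [toricH_eq_sum hP hne, ← Finset.sum_fiberwise_of_maps_to
    (g := fun G => (dim G + 1).toNat) (t := Finset.range (d + 1))]
  · refine Finset.sum_congr rfl fun i hi => ?_
    rw [Finset.mem_range] at hi
    have hfilter : (hP.finite_faces.toFinset.erase P).filter (fun G => (dim G + 1).toNat = i) =
        facesOfDim hP ((i : ℤ) - 1) := by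
      ext G
      simp only [Finset.mem_filter, Finset.mem_erase, Set.Finite.mem_toFinset, Set.mem_ofPred_eq,
        mem_facesOfDim]
      have := neg_one_le_dim G
      constructor
      · rintro ⟨⟨-, hG⟩, hdim⟩
        exact ⟨hG, by omega⟩
      · rintro ⟨hG, hdim⟩
        refine ⟨⟨?_, hG⟩, by omega⟩
        rintro rfl
        have := h.2.1
        omega
    have hcard : (C ((facesOfDim hP ((i : ℤ) - 1)).card : ℤ) : ℤ[X]) =
        ∑ _G ∈ facesOfDim hP ((i : ℤ) - 1), 1 := by simp
    rw [hfilter, fNum_eq hP, excess_eq hP, map_sum, hcard, Finset.sum_mul,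
      ← Finset.sum_add_distrib, Finset.sum_mul]
    refine Finset.sum_congr rfl fun G hG => ?_
    rw [mem_facesOfDim] at hG
    have hGP : G ≠ P := by
      rintro rfl
      have := h.2.1
      omega
    rw [h.toricG_face hG.1 hGP, linearG, h.2.1, hG.2]
    congr 2
    omega
  · intro G hG
    rw [Finset.mem_erase, Set.Finite.mem_toFinset] at hG
    have := dim_lt_of_properFace hG.2 hG.1
    rw [h.2.1] at this
    rw [Finset.mem_range]
    omega

/-- Collect a sum of terms `a i + b i x` by powers of `x - 1`. -/
theorem sum_linear_mul_pow (d : ℕ) (a b : ℕ → ℤ) (hb : b 0 = 0) :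
    ∑ i ∈ Finset.range (d + 1), (C (a i) + C (b i) * X) * (X - 1 : ℤ[X]) ^ (d - i) =
      ∑ i ∈ Finset.range (d + 1),
        C (a i + b i + if i < d then b (i + 1) else 0) * (X - 1 : ℤ[X]) ^ (d - i) := by
  -- Writing `X = (X - 1) + 1`, the part with an extra factor `X - 1` shifts `b` by one index; `b 0
  -- = 0` removes the stray power `d + 1`.
  have h1 : ∑ i ∈ Finset.range (d + 1), C (b i) * (X - 1 : ℤ[X]) ^ (d - i + 1) =
      ∑ i ∈ Finset.range (d + 1),
        C (if i < d then b (i + 1) else 0) * (X - 1 : ℤ[X]) ^ (d - i) := by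
    rw [Finset.sum_range_succ', Finset.sum_range_succ (n := d), hb, if_neg (lt_irrefl d)]
    simp only [map_zero, zero_mul, add_zero]
    refine Finset.sum_congr rfl fun i hi => ?_
    rw [Finset.mem_range] at hi
    rw [if_pos hi, show d - (i + 1) + 1 = d - i by omega]
  simp only [map_add, add_mul (R := ℤ[X]), Finset.sum_add_distrib]
  rw [← h1, add_assoc]
  simp only [← Finset.sum_add_distrib]
  refine Finset.sum_congr rfl fun i _ => ?_
  ring

theorem IsMultiplicial.toricH_eq {d : ℕ} {P : Set E} (h : IsMultiplicial d P) :
    toricH P = ∑ i ∈ Finset.range (d + 1), C (fBar P ((i : ℤ) - 1)) * (X - 1) ^ (d - i) := by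
  rw [h.toricH_eq_sum_dim, sum_linear_mul_pow d (fun i => (fNum P ((i : ℤ) - 1) : ℤ))
    (fun i => excess P ((i : ℤ) - 1))]
  · refine Finset.sum_congr rfl fun i hi => ?_
    rw [h.fBar_eq (Nat.lt_succ_iff.1 (Finset.mem_range.1 hi))]
    push_cast
    rw [add_sub_cancel_right]
  · simp only [Nat.cast_zero]
    exact h.excess_eq_zero (by norm_num) (by omega)

theorem eq_sum_hCoeff {d : ℕ} {H : ℤ[X]} (hH : H.natDegree ≤ d) :
    H = ∑ i ∈ Finset.range (d + 1), C (hCoeff d H i) * X ^ (d - i) := by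
  conv_lhs => rw [H.as_sum_range_C_mul_X_pow' (Nat.lt_succ_of_le hH)]
  rw [← Finset.sum_range_reflect]
  rfl

end FaceNumbers

end ConvPoly

theorem mainTheorem8 {E : Type*} [NormedAddCommGroup E] [NormedSpace ℝ E] [FiniteDimensional ℝ E]
    (d : ℕ) (P : Set E) (hP : ConvPoly.IsMultiplicial d P) :
    ConvPoly.toricH P =
        ∑ i ∈ Finset.range (d + 1), C (ConvPoly.toricHVec P i) * X ^ (d - i) ∧
      ConvPoly.toricH P =
        ∑ i ∈ Finset.range (d + 1), C (ConvPoly.fBar P ((i : ℤ) - 1)) * (X - 1) ^ (d - i) := by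
  have h2 := hP.toricH_eq
  refine ⟨?_, h2⟩
  have hdim : (ConvPoly.dim P).toNat = d := by
    rw [hP.2.1, Int.toNat_natCast]
  unfold ConvPoly.toricHVec
  rw [hdim]
  -- The required degree bound is read off from the expansion in powers of `X - 1`.
  refine ConvPoly.eq_sum_hCoeff ?_
  rw [h2]
  refine natDegree_sum_le_of_forall_le _ _ fun i _ => ?_
  refine (natDegree_C_mul_le _ _).trans ((natDegree_pow_le_of_le (d - i)
    (natDegree_X_sub_C_le (1 : ℤ))).trans ?_)
  omega
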